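/- **Definitions.** A *mixed graph* $\mathcal H$ has nodes $\mathcal V$ and edges of the types $\to,\leftarrow,\leftrightarrow,-$; each edge has a mark (tail or arrowhead) at each end, and $*$ stands for either mark. Nodes joined by an edge are *adjacent*. A *walk* is a finite alternating sequence of nodes and edges (possibly a single node); a *path* is a walk without repeated nodes. $a\in\mathrm{Anc}(b)$ means that there is a (possibly trivial) directed walk $a\to\cdots\to b$; $\mathrm{Anc}(A)=\bigcup_{v\in A}\mathrm{Anc}(v)$; and $\mathrm{Sc}(v)$ is the set of $w$ with $w\in\mathrm{Anc}(v)$ and $v\in\mathrm{Anc}(w)$. A non-endpoint node $v_k$ of a walk is a *collider* if $v_{k-1}\mathrel{*\!\!\to}v_k\mathrel{\leftarrow\!\!*}v_{k+1}$; all other nodes, including the endpoints, are *non-colliders*. A *$\sigma$-MAG* is a mixed graph such that: (1) there is at most one edge between any two distinct nodes, and no node is adjacent to itself; (2) if there is a path $a -\!\!* \cdots -\!\!*\, b$ (a tail at the earlier node of each edge), then there is no edge $a\mathrel{\leftarrow\!\!*}b$; (3) there is no path between two distinct non-adjacent nodes $a,b$ all of whose non-endpoint nodes are colliders in $\mathrm{Anc}(\{a,b\})$;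 (4) if $a\mathrel{*\!\!\to}b - c$, then $a$ and $c$ are adjacent, and if moreover $b - d$ with $d\ne c$, then $c$ and $d$ are adjacent. A *directed mixed graph* (DMG) has directed and bidirected edges only and no self-loops; distinct nodes may be joined by several edges, at most one of each type $\to$, $\leftarrow$, $\leftrightarrow$. In a DMG $\mathcal G$, a non-endpoint non-collider on a walk is *unblockable* if each edge of the walk directed out of it leads to a node in its own strongly connected component; all other non-colliders are *blockable*. A walk is *$\sigma$-blocked* by $Z$ if it has a collider outside $\mathrm{Anc}_{\mathcal G}(Z)$ or a blockable non-collider in $Z$. $X$ is *$\sigma$-separated* from $Y$ given $Z$ if every walk from a node of $X$ to a node of $Y$ is $\sigma$-blocked by $Z$. Let $\mathcal V$ and $\mathcal S$ be disjoint. DMGs $\mathcal G_1,\mathcal G_2$ on $\mathcal V\cup\mathcal S$ are *$\sigma$-Markov equivalent given $\mathcal S$* if for all $X,Y,Z\subseteq\mathcal V$: $X$ is $\sigma$-separated from $Y$ given $Z\cup\mathcal S$ in $\mathcal G_1$ if and only if this holds in $\mathcal G_2$. A mixed graph $\mathcal H$ on $\mathcal V$ *represents* a DMG $\mathcal G$ on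 $\mathcal V\cup\mathcal S$ *given $\mathcal S$* if: (i) $\mathcal H$ satisfies (1); (ii) distinct $a,b\in\mathcal V$ are adjacent in $\mathcal H$ if and only if there is a path in $\mathcal G$ between $a$ and $b$ whose colliders are all in $\mathrm{Anc}_{\mathcal G}(\{a,b\}\cup\mathcal S)$ and whose non-endpoint non-colliders are all unblockable; (iii) if $a\mathrel{\leftarrow\!\!*}b$ in $\mathcal H$, then $a\notin\mathrm{Anc}_{\mathcal G}(\{b\}\cup\mathcal S)$; (iv) if $a -\!\!*\, b$ in $\mathcal H$, then $a\in\mathrm{Anc}_{\mathcal G}(\{b\}\cup\mathcal S)$. In a $\sigma$-MAG, an *unshielded collider* is a triple of distinct nodes $(a,b,c)$ with $a\mathrel{*\!\!\to}b\mathrel{\leftarrow\!\!*}c$ and $a,c$ non-adjacent. A path $(a,v_0,\dots,v_n,b,c)$ with $n\ge0$ is a *discriminating path for $b$* if $a$ is not adjacent to $c$ and every $v_k$ ($0\le k\le n$) is a collider on the path with $v_k\to c$. **Theorem.** Let $\mathcal G_1,\mathcal G_2$ be DMGs on the same node set $\mathcal V\cup\mathcal S$, where $\mathcal V$ and $\mathcal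 S$ are disjoint, and let $\mathcal H_1,\mathcal H_2$ be $\sigma$-MAGs on $\mathcal V$ that represent $\mathcal G_1,\mathcal G_2$ given $\mathcal S$, respectively. Then $\mathcal G_1$ and $\mathcal G_2$ are $\sigma$-Markov equivalent given $\mathcal S$ if and only if 1. $\mathcal H_1$ and $\mathcal H_2$ have the same adjacencies; 2. $\mathcal H_1$ and $\mathcal H_2$ have the same unshielded colliders; and 3. whenever a path $\pi_1$ in $\mathcal H_1$ and a path $\pi_2$ in $\mathcal H_2$ have the same sequence of nodes and are both discriminating paths for a node $v$, then $v$ is a collider on $\pi_1$ if and only if it is a collider on $\pi_2$. -/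

import Mathlib

/-- The two possible marks of an edge at one of its end nodes. -/
inductive EdgeMark : Type
  | tail
  | arrow

/-- A mixed graph on the node set `V`. `edge a m n b` says that the graph contains the edge between
`a` and `b` which has mark `m` at `a` and mark `n` at `b`:
`edge a tail arrow b` is `a → b`, `edge a arrow tail b` is `a ← b`,
`edge a arrow arrow b` is `a ↔ b`, and `edge a tail tail b` is `a - b`.
Several edges of different types between the same two nodes, and self-loops, are allowed. -/
structure MixedGraph (V : Type*) where
  edge : V → EdgeMark → EdgeMark → V → Prop
  symm : ∀ a m n b, edge a m n b → edge b n m a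

namespace MixedGraph

variable {V : Type*} (H : MixedGraph V)

/-- The directed edge `a → b`. -/
def Dir (a b : V) : Prop := H.edge a .tail .arrow b

/-- The undirected edge `a - b`. -/
def Undir (a b : V) : Prop := H.edge a .tail .tail b

/-- There is an edge between `a` and `b` that is into `b`. -/
def Into (a b : V) : Prop := ∃ m, H.edge a m .arrow b

/-- There is an edge between `a` and `b` that is out of `a` (it has a tail at `a`). -/
def OutOf (a b : V) : Prop := ∃ n, H.edge a .tail n b

/-- `a` and `b` are adjacent. -/
def Adj (a b : V) : Prop := ∃ m n, H.edge a m n b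

/-- The set of ancestors of the nodes in `A`: nodes with a (possibly trivial) directed walk to a
node of `A`. -/
def anc (A : Set V) : Set V := {w | ∃ v ∈ A, Relation.ReflTransGen H.Dir w v}

/-- The strongly connected component of `v`: the nodes that are both ancestors and descendants
of `v`. -/
def sc (v : V) : Set V :=
  {w | Relation.ReflTransGen H.Dir w v ∧ Relation.ReflTransGen H.Dir v w}

/-- A walk with `length` edges. Its nodes are `node 0, …, node length`; its edges are numbered
`0, …, length - 1`, and edge `i` connects `node i` and `node (i + 1)`, with mark `startMark i` at
`node i` and mark `endMark i` at `node (i + 1)`. Values of the three functions at larger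
arguments have no meaning and are never used. -/
structure Walk where
  length : ℕ
  node : ℕ → V
  startMark : ℕ → EdgeMark
  endMark : ℕ → EdgeMark
  isEdge : ∀ i < length, H.edge (node i) (startMark i) (endMark i) (node (i + 1))

namespace Walk

variable {H} (π : H.Walk)

/-- The first node of a walk. -/
def first : V := π.node 0

/-- The last node of a walk. -/
def last : V := π.node π.length

/-- A path is a walk on which no node appears more than once. -/
def IsPath : Prop := ∀ i ≤ π.length, ∀ j ≤ π.length, π.node i = π.node j → i = j

/-- An anterior walk: each edge has a tail at its earlier node. -/
def IsAnterior : Prop := ∀ i < π.length, π.startMark i = .tail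

/-- Position `k` is not an endpoint of the walk. -/
def IsInner (k : ℕ) : Prop := 0 < k ∧ k < π.length

/-- The node at position `k` is a collider: `node (k-1) *→ node k ←* node (k+1)`. -/
def IsCollider (k : ℕ) : Prop :=
  π.IsInner k ∧ π.endMark (k - 1) = .arrow ∧ π.startMark k = .arrow

/-- The node at position `k` is a non-collider; the endpoints are non-colliders. -/
def IsNonCollider (k : ℕ) : Prop := k ≤ π.length ∧ ¬ π.IsCollider k

/-- Inducing walk: every non-endpoint node is a collider and an ancestor of one of the
endpoints. -/
def IsInducing : Prop :=
  ∀ k, π.IsInner k → π.IsCollider k ∧ π.node k ∈ H.anc {π.first, π.last}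

/-- For `π = (a, v_0, …, v_n, b, c)` with `n ≥ 0`, `π` is a discriminating path for `b`: `a` and
`c` are not adjacent, and every `v_k` is a collider on `π` and a parent of `c`. The node `v_k` is at
position `k + 1`, `b` at position `n + 2`, and `c` at position `n + 3`. -/
def IsDiscriminating (b : V) : Prop :=
  ∃ n, π.length = n + 3 ∧ π.IsPath ∧ π.node (n + 2) = b ∧ ¬ H.Adj π.first π.last ∧
    ∀ k ≤ n, π.IsCollider (k + 1) ∧ H.Dir (π.node (k + 1)) π.last

/-- The node `v` occurs as a collider on the walk. -/
def HasCollider (v : V) : Prop := ∃ k, π.node k = v ∧ π.IsCollider k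

end Walk

/-- A σ-maximal ancestral graph (σ-MAG). -/
structure IsSigmaMAG : Prop where
  /-- There is at most one edge between two distinct nodes. -/
  simple : ∀ a b m n m' n', a ≠ b → H.edge a m n b → H.edge a m' n' b → m = m' ∧ n = n'
  /-- No node is adjacent to itself. -/
  loopless : ∀ a, ¬ H.Adj a a
  /-- Ancestral: if there is an anterior path from `a` to `b`, then there is no edge between `a`
  and `b` that is into `a`. -/
  ancestral : ∀ π : H.Walk, π.IsPath → π.IsAnterior → ¬ H.Into π.last π.first
  /-- Maximal: no inducing path between two distinct non-adjacent nodes. -/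
  maximal : ∀ a b, a ≠ b → ¬ H.Adj a b →
    ¬ ∃ π : H.Walk, π.first = a ∧ π.last = b ∧ π.IsPath ∧ π.IsInducing
  /-- σ-complete, first part: `a *→ b - c` implies that `a` and `c` are adjacent. -/
  complete_adj : ∀ a b c, H.Into a b → H.Undir b c → H.Adj a c
  /-- σ-complete, second part: if `a *→ b - c` and `b - d` with `d ≠ c`, then `c` and `d` are
  adjacent. -/
  complete_nbh : ∀ a b c d, H.Into a b → H.Undir b c → H.Undir b d → c ≠ d → H.Adj c d

/-- `(a, b, c)` is an unshielded triple of distinct nodes with `a *→ b ←* c`. -/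
def IsUnshieldedCollider (a b c : V) : Prop :=
  a ≠ b ∧ b ≠ c ∧ a ≠ c ∧ ¬ H.Adj a c ∧ H.Into a b ∧ H.Into c b

/-- The two mixed graphs have the same adjacencies, the same unshielded colliders, and the same
collider status on common discriminating paths: whenever `π₁` in `H₁` and `π₂` in `H₂` run through
the same sequence of nodes and are both discriminating for `v`, then `v` is a collider on `π₁` iff it
is one on `π₂`. -/
structure SameBasicColliders (H₁ H₂ : MixedGraph V) : Prop where
  adj : ∀ a b, H₁.Adj a b ↔ H₂.Adj a b
  unshielded : ∀ a b c, H₁.IsUnshieldedCollider a b c ↔ H₂.IsUnshieldedCollider a b c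
  discriminating : ∀ (π₁ : H₁.Walk) (π₂ : H₂.Walk) (v : V),
    π₁.length = π₂.length → (∀ i ≤ π₁.length, π₁.node i = π₂.node i) →
    π₁.IsDiscriminating v → π₂.IsDiscriminating v → (π₁.HasCollider v ↔ π₂.HasCollider v)

end MixedGraph

/-- A directed mixed graph (DMG): only directed and bidirected edges, and no self-loops. Between two
distinct nodes there may be several edges, at most one of each of the types `→`, `←`, `↔`. -/
structure DMG (W : Type*) extends MixedGraph W where
  no_undir : ∀ a b, ¬ edge a .tail .tail b
  loopless : ∀ a m n, ¬ edge a m n a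

namespace MixedGraph.Walk

variable {W : Type*} {G : MixedGraph W} (π : G.Walk)

/-- Position `k` is an unblockable non-collider: a non-endpoint non-collider all of whose outgoing
edges on the walk lead to nodes in its own strongly connected component. (Used only in DMGs, where
an edge with a tail at a node is a directed edge out of that node.) -/
def IsUnblockable (k : ℕ) : Prop :=
  π.IsInner k ∧ π.IsNonCollider k ∧
    (π.endMark (k - 1) = .tail → π.node (k - 1) ∈ G.sc (π.node k)) ∧
    (π.startMark k = .tail → π.node (k + 1) ∈ G.sc (π.node k))

/-- Position `k` is a blockable non-collider. -/
def IsBlockable (k : ℕ) : Prop := π.IsNonCollider k ∧ ¬ π.IsUnblockable k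

/-- The walk is σ-blocked by `Z`. -/
def IsSigmaBlocked (Z : Set W) : Prop :=
  (∃ k, π.IsCollider k ∧ π.node k ∉ G.anc Z) ∨ (∃ k, π.IsBlockable k ∧ π.node k ∈ Z)

/-- The walk is σ-inducing given `S`. -/
def IsSigmaInducing (S : Set W) : Prop :=
  (∀ k, π.IsCollider k → π.node k ∈ G.anc ({π.first, π.last} ∪ S)) ∧
    ∀ k, π.IsInner k → π.IsNonCollider k → π.IsUnblockable k

end MixedGraph.Walk

namespace DMG

/-- `X` is σ-separated from `Y` given `Z`: each walk from a node in `X` to a node in `Y` is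
σ-blocked by `Z`. -/
def SigmaSep {W : Type*} (G : DMG W) (X Y Z : Set W) : Prop :=
  ∀ π : G.toMixedGraph.Walk, π.first ∈ X → π.last ∈ Y → π.IsSigmaBlocked Z

/-- σ-Markov equivalence given `S` of two DMGs on the disjoint union of `V` and `S`. -/
def SigmaMarkovEquiv {V S : Type*} (G₁ G₂ : DMG (V ⊕ S)) : Prop :=
  ∀ X Y Z : Set V,
    G₁.SigmaSep (Sum.inl '' X) (Sum.inl '' Y) (Sum.inl '' Z ∪ Set.range Sum.inr) ↔
      G₂.SigmaSep (Sum.inl '' X) (Sum.inl '' Y) (Sum.inl '' Z ∪ Set.range Sum.inr)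

end DMG

/-- The mixed graph `H` on `V` represents the DMG `G` on the disjoint union of `V` and `S`,
given `S`. -/
structure MixedGraph.Represents {V S : Type*} (H : MixedGraph V) (G : DMG (V ⊕ S)) : Prop where
  simple : ∀ a b m n m' n', a ≠ b → H.edge a m n b → H.edge a m' n' b → m = m' ∧ n = n'
  loopless : ∀ a, ¬ H.Adj a a
  adj_iff : ∀ a b, a ≠ b → (H.Adj a b ↔
    ∃ π : G.toMixedGraph.Walk, π.first = Sum.inl a ∧ π.last = Sum.inl b ∧ π.IsPath ∧
      π.IsSigmaInducing (Set.range Sum.inr))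
  /-- If `a ←* b` in `H`, then `a` is not an ancestor of `b` or of a node of `S` in `G`. -/
  arrow : ∀ a b, H.Into b a → Sum.inl a ∉ G.anc ({Sum.inl b} ∪ Set.range Sum.inr)
  /-- If `a -* b` in `H`, then `a` is an ancestor of `b` or of a node of `S` in `G`. -/
  tail : ∀ a b, H.OutOf a b → Sum.inl a ∈ G.anc ({Sum.inl b} ∪ Set.range Sum.inr)

/-! A graph representing `G` is determined by its adjacencies and the preorder `AntLE`: an edge has
a tail at `x` towards `y` exactly when `x` is an ancestor of `y` or of a selection node.
`AnteriorGraph` keeps only this data. For distinct `a` and `b`, `G` connects them given `Z` and the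
selection nodes iff `H` has a walk between them, inside the ancestral set of `a`, `b`, `Z` and the
selection nodes, whose inner nodes in `Z` are all colliders (`connects_of_openWalk`,
`openWalk_of_connects`). It remains to compare such walks in `H₁` and `H₂`.

From equivalence to equal colliders: non-adjacent nodes can be separated (`exists_not_connects`),
which gives equal adjacencies. If one graph had a collider and the other a non-collider at the
critical node of an unshielded triple or a discriminating path, a set separating the end nodes in
one graph would fail to do so in one of the two (`coll_of_coll`).

Conversely, choose an open walk in the first graph of least length and, among those, with least
total distance to `{a, b} ∪ Z`. Every chord of such a tight walk is directed out of a collider in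
`Z` (`exists_tightWalk`). A shielded triple on it is therefore the end of a discriminating path made
of such colliders, read from the left or from the right. Since these paths cannot cross badly
(`not_crossing_runs`), an induction shows that both graphs have the same colliders on the walk
(`TightWalk.agree`). Least distance makes a shortest anterior walk from a collider to `{a, b} ∪ Z`
directed in both graphs (`dir_of_dist_lt`, `mem_of_dir`), so colliders stay ancestral;
σ-completeness then carries this to the other nodes (`mem_of_sameColliders`). -/

/-! ### Labelled chains: concatenation, splicing and excision. -/

/-- Non-empty chains of labelled edges: `Chain E J f a p b q n k` says that `a` and `b` are connected
by `n` edges of `E`, with label `p` at `a` and label `q` at `b`, such that `J` holds at each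
intermediate node with its two labels; `k` is the sum of the weights `f` of all nodes after `a`. -/
inductive Chain {W ι : Type*} (E : W → ι → ι → W → Prop) (J : W → ι → ι → Prop) (f : W → ℕ) :
    W → ι → W → ι → ℕ → ℕ → Prop
  | single {a p q b} : E a p q b → Chain E J f a p b q 1 (f b)
  | cons {a p q b r c s n k} : E a p q b → J b q r → Chain E J f b r c s n k →
      Chain E J f a p c s (n + 1) (f b + k)

/-- A chain of `n` labelled edges, given by functions on positions. -/
structure Trail {W ι : Type*} (E : W → ι → ι → W → Prop) (J : W → ι → ι → Prop) (n : ℕ) where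
  node : ℕ → W
  start : ℕ → ι
  fin : ℕ → ι
  edge : ∀ i < n, E (node i) (start i) (fin i) (node (i + 1))
  junction : ∀ i, i + 1 < n → J (node (i + 1)) (fin i) (start (i + 1))

namespace Chain

variable {W ι : Type*} {E : W → ι → ι → W → Prop} {J : W → ι → ι → Prop} {f : W → ℕ}

theorem pos {a p b q n k} (h : Chain E J f a p b q n k) : 0 < n := by
  cases h <;> omega

theorem congr_nat {a p b q n k n' k'} (h : Chain E J f a p b q n k) (hn : n = n') (hk : k = k') :
    Chain E J f a p b q n' k' := hn ▸ hk ▸ h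

theorem append {a p b q n k r c s m l} (h₁ : Chain E J f a p b q n k) (hJ : J b q r)
    (h₂ : Chain E J f b r c s m l) : Chain E J f a p c s (n + m) (k + l) := by
  induction h₁ with
  | single e => rw [add_comm 1 m]; exact .cons e hJ h₂
  | cons e j _ ih =>
    exact (Chain.cons e j (ih hJ h₂)).congr_nat (by omega) (by omega)

theorem mono {E' : W → ι → ι → W → Prop} {J' : W → ι → ι → Prop}
    (hE : ∀ a p q b, E a p q b → E' a p q b) (hJ : ∀ x q r, J x q r → J' x q r)
    {a p b q n k} (h : Chain E J f a p b q n k) : Chain E' J' f a p b q n k := by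
  induction h with
  | single e => exact .single (hE _ _ _ _ e)
  | cons e j _ ih => exact .cons (hE _ _ _ _ e) (hJ _ _ _ j) ih

theorem reverse (hE : ∀ a p q b, E a p q b → E b q p a) (hJ : ∀ x q r, J x q r → J x r q)
    {a p b q n k} (h : Chain E J f a p b q n k) : ∃ k', Chain E J f b q a p n k' := by
  induction h with
  | single e => exact ⟨_, .single (hE _ _ _ _ e)⟩
  | cons e j _ ih =>
    obtain ⟨k', hk⟩ := ih
    exact ⟨_, hk.append (hJ _ _ _ j) (.single (hE _ _ _ _ e))⟩

theorem exists_trail {a p b q n k} (h : Chain E J f a p b q n k) :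
    ∃ T : Trail E J n, T.node 0 = a ∧ T.start 0 = p ∧ T.node n = b ∧ T.fin (n - 1) = q ∧
      k = ∑ i ∈ Finset.range n, f (T.node (i + 1)) := by
  induction h with
  | @single a p q b e =>
    refine ⟨⟨fun i => if i = 0 then a else b, fun _ => p, fun _ => q, ?_, ?_⟩, ?_⟩
    · intro i hi
      obtain rfl : i = 0 := by omega
      simpa using e
    · intro i hi; omega
    · simp
  | @cons a p q b r c s n k e j h ih =>
    obtain ⟨T, h0, h1, h2, h3, h4⟩ := ih
    have hn := h.pos
    refine ⟨⟨fun i => i.casesOn a T.node, fun i => i.casesOn p T.start, fun i => i.casesOn q T.fin,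
      ?_, ?_⟩, rfl, rfl, h2, ?_, ?_⟩
    · rintro (_ | i) hi
      · simpa [h0] using e
      · exact T.edge i (by omega)
    · rintro (_ | i) hi
      · simpa [h0, h1] using j
      · exact T.junction i (by omega)
    · obtain ⟨m, rfl⟩ : ∃ m, n = m + 1 := ⟨n - 1, by omega⟩
      simpa using h3
    · rw [Finset.sum_range_succ', add_comm]
      simp [h0, h4]

end Chain

namespace Trail

variable {W ι : Type*} {E : W → ι → ι → W → Prop} {J : W → ι → ι → Prop} {n : ℕ}
  (T : Trail E J n) (f : W → ℕ)

theorem chain_aux (d : ℕ) : ∀ i, i + d + 1 ≤ n →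
    Chain E J f (T.node i) (T.start i) (T.node (i + d + 1)) (T.fin (i + d)) (d + 1)
      (∑ t ∈ Finset.range (d + 1), f (T.node (i + t + 1))) := by
  induction d with
  | zero => intro i hi; simpa using Chain.single (J := J) (f := f) (T.edge i (by omega))
  | succ d ih =>
    intro i hi
    have h := Chain.cons (T.edge i (by omega)) (T.junction i (by omega)) (ih (i + 1) (by omega))
    rw [Finset.sum_range_succ', add_comm (Finset.sum _ _)]
    have e : ∀ t, i + 1 + t = i + (t + 1) := by intro t; omega
    simp only [e] at h
    exact h

theorem chain {i j : ℕ} (hij : i < j) (hj : j ≤ n) :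
    Chain E J f (T.node i) (T.start i) (T.node j) (T.fin (j - 1)) (j - i)
      (∑ t ∈ Finset.Ico i j, f (T.node (t + 1))) := by
  have h := T.chain_aux f (j - i - 1) i (by omega)
  rw [Finset.sum_Ico_eq_sum_range]
  rwa [show i + (j - i - 1) + 1 = j by omega, show i + (j - i - 1) = j - 1 by omega,
    show j - i - 1 + 1 = j - i by omega] at h

/-- Replace the part of a trail between positions `i` and `j` by another chain. -/
theorem splice {i j : ℕ} (hij : i ≤ j) (hj : j ≤ n) {p q m k}
    (h : Chain E J f (T.node i) p (T.node j) q m k)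
    (hl : 0 < i → J (T.node i) (T.fin (i - 1)) p) (hr : j < n → J (T.node j) q (T.start j)) :
    ∃ p' q', Chain E J f (T.node 0) p' (T.node n) q' (n - (j - i) + m)
      (∑ t ∈ Finset.range i, f (T.node (t + 1)) + k + ∑ t ∈ Finset.Ico j n, f (T.node (t + 1))) := by
  have h1 : ∃ p' , Chain E J f (T.node 0) p' (T.node j) q (i + m)
      (∑ t ∈ Finset.range i, f (T.node (t + 1)) + k) := by
    rcases Nat.eq_zero_or_pos i with rfl | hi
    · exact ⟨p, by simpa using h⟩
    · have := (T.chain f hi (hij.trans hj)).append (hl hi) h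
      rw [Nat.Ico_zero_eq_range] at this
      exact ⟨_, this⟩
  obtain ⟨p', h1⟩ := h1
  rcases hj.lt_or_eq with hj' | rfl
  · have := h1.append (hr hj') (T.chain f hj' le_rfl)
    exact ⟨_, _, this.congr_nat (by omega) rfl⟩
  · exact ⟨p', q, h1.congr_nat (by omega) (by simp)⟩

/-- Cut out the part of a trail between two visits to the same node. -/
theorem excise {i j : ℕ} (hij : i < j) (hj : j ≤ n) (hne : 0 < i ∨ j < n)
    (heq : T.node i = T.node j)
    (hJ : 0 < i → j < n → J (T.node i) (T.fin (i - 1)) (T.start j)) :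
    ∃ p' q' k, Chain E J f (T.node 0) p' (T.node n) q' (n - (j - i)) k := by
  rcases Nat.eq_zero_or_pos i with rfl | hi
  · have hj' : j < n := by omega
    rw [heq]
    exact ⟨_, _, _, T.chain f hj' le_rfl⟩
  · rcases hj.lt_or_eq with hj' | rfl
    · have h1 := T.chain f hi (by omega)
      have h2 := T.chain f hj' le_rfl
      rw [← heq] at h2
      have := h1.append (hJ hi hj') h2
      exact ⟨_, _, _, this.congr_nat (by omega) rfl⟩
    · rw [← heq]
      exact ⟨_, _, _, (T.chain f hi (by omega)).congr_nat (by omega) rfl⟩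

end Trail

/-! ### Anterior graphs and tight walks. -/

/-- The adjacencies of a simple mixed graph together with a preorder that determines its edge marks:
the edge between adjacent nodes `a` and `b` has a tail at `a` if and only if `le a b`. The remaining
fields say that the graph is σ-complete and maximal. -/
structure AnteriorGraph (V : Type*) where
  adj : V → V → Prop
  le : V → V → Prop
  symm : ∀ {a b}, adj a b → adj b a
  irrefl : ∀ {a}, ¬ adj a a
  trans : ∀ {a b c}, le a b → le b c → le a c
  complete_adj : ∀ {a b c}, adj a b → ¬ le b a → adj b c → le b c → le c b → adj a c
  complete_nbh : ∀ {a b c d}, adj a b → ¬ le b a → adj b c → le b c → le c b →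
    adj b d → le b d → le d b → c ≠ d → adj c d
  maximal : ∀ (n : ℕ) (x : ℕ → V), (∀ i ≤ n, ∀ j ≤ n, x i = x j → i = j) →
    (∀ i < n, adj (x i) (x (i + 1))) → x 0 ≠ x n → ¬ adj (x 0) (x n) →
    ¬ ∀ i, 0 < i → i < n → (¬ le (x i) (x (i - 1)) ∧ ¬ le (x i) (x (i + 1))) ∧
      ((adj (x i) (x 0) ∧ le (x i) (x 0) ∧ ¬ le (x 0) (x i)) ∨
        (adj (x i) (x n) ∧ le (x i) (x n) ∧ ¬ le (x n) (x i)))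

namespace AnteriorGraph

variable {V : Type*} (M : AnteriorGraph V)

/-- The directed edge `a → b`. -/
def Dir (a b : V) : Prop := M.adj a b ∧ M.le a b ∧ ¬ M.le b a

/-- For `u` and `v` adjacent to `x`, the node `x` is a collider between `u` and `v`. -/
def Coll (u x v : V) : Prop := ¬ M.le x u ∧ ¬ M.le x v

theorem coll_comm {u x v : V} : M.Coll u x v ↔ M.Coll v x u := and_comm

theorem Dir.ne {M : AnteriorGraph V} {a b : V} (h : M.Dir a b) : a ≠ b := by
  rintro rfl; exact M.irrefl h.1

/-- The edges, labelled at each end with the node at the other end. -/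
def Edge (a p q b : V) : Prop := M.adj a b ∧ p = b ∧ q = a

/-- The condition on the intermediate nodes of a walk to be open given `Z` inside `A`. -/
def Open (A Z : Set V) (x u v : V) : Prop := x ∈ A ∧ (x ∈ Z → M.Coll u x v)

/-- There is an anterior walk of length `r` from `y` to a node of `B`. -/
def Reaches (B : Set V) : ℕ → V → Prop
  | 0, y => y ∈ B
  | r + 1, y => ∃ d, M.adj y d ∧ M.le y d ∧ Reaches B r d

/-- The least length of an anterior walk from `y` to a node of `B`. -/
noncomputable def dist (B : Set V) (y : V) : ℕ := sInf {r | M.Reaches B r y}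

theorem reaches_dist {B : Set V} {r : ℕ} {y : V} (h : M.Reaches B r y) :
    M.Reaches B (M.dist B y) y := Nat.sInf_mem (s := {r | M.Reaches B r y}) ⟨r, h⟩

theorem dist_le {B : Set V} {r : ℕ} {y : V} (h : M.Reaches B r y) : M.dist B y ≤ r :=
  Nat.sInf_le (s := {r | M.Reaches B r y}) h

theorem mem_of_reaches {A B : Set V} (hB : B ⊆ A)
    (hA : ∀ x y, M.adj x y → M.le x y → y ∈ A → x ∈ A) {r : ℕ} {y : V} (h : M.Reaches B r y) :
    y ∈ A := by
  induction r generalizing y with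
  | zero => exact hB h
  | succ r ih => obtain ⟨d, h1, h2, h3⟩ := h; exact hA _ _ h1 h2 (ih h3)

/-- Same adjacencies, and same colliders on unshielded triples and on common discriminating
paths. -/
structure SameColliders (M₁ M₂ : AnteriorGraph V) : Prop where
  adj : ∀ a b, M₁.adj a b ↔ M₂.adj a b
  unshielded : ∀ a b c, a ≠ c → ¬ M₁.adj a c → M₁.adj a b → M₁.adj b c →
    (M₁.Coll a b c ↔ M₂.Coll a b c)
  discriminating : ∀ (n : ℕ) (x : ℕ → V), (∀ i ≤ n + 3, ∀ j ≤ n + 3, x i = x j → i = j) →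
    (∀ i < n + 3, M₁.adj (x i) (x (i + 1))) → ¬ M₁.adj (x 0) (x (n + 3)) →
    (∀ k ≤ n, M₁.Coll (x k) (x (k + 1)) (x (k + 2)) ∧ M₁.Dir (x (k + 1)) (x (n + 3))) →
    (∀ k ≤ n, M₂.Coll (x k) (x (k + 1)) (x (k + 2)) ∧ M₂.Dir (x (k + 1)) (x (n + 3))) →
    (M₁.Coll (x (n + 1)) (x (n + 2)) (x (n + 3)) ↔ M₂.Coll (x (n + 1)) (x (n + 2)) (x (n + 3)))

/-- A walk that is open given `Z` inside `A` and cannot be shortened, nor moved closer to `B`. -/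
structure TightWalk (A B Z : Set V) (n : ℕ) (w : ℕ → V) : Prop where
  adj : ∀ i < n, M.adj (w i) (w (i + 1))
  mem : ∀ i ≤ n, w i ∈ A
  coll : ∀ i ≤ n, w i ∈ Z → 0 < i ∧ i < n ∧ M.Coll (w (i - 1)) (w i) (w (i + 1))
  inj : ∀ i ≤ n, ∀ j ≤ n, w i = w j → i = j
  chord : ∀ i j, i + 2 ≤ j → j ≤ n → M.adj (w i) (w j) →
    (w i ∈ Z ∧ M.Dir (w i) (w j)) ∨ (w j ∈ Z ∧ M.Dir (w j) (w i))
  replace : ∀ k l d, k + 2 ≤ l → l ≤ n → d ∈ A → M.adj (w k) d → M.adj d (w l) →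
    M.Coll (w k) d (w l) → (w k ∈ Z → ¬ M.le (w k) d) → (w l ∈ Z → ¬ M.le (w l) d) →
    l = k + 2 ∧ M.dist B (w (k + 1)) ≤ M.dist B d

/-! ### Agreement of colliders on tight walks. -/

section

variable {M} {M₁ M₂ : AnteriorGraph V}

namespace SameColliders

/-- Treats both hypotheses on colliders at once: for `m = 1` the triple is unshielded, and for `m ≥
2` the run followed by `c` is a discriminating path for `x m`. -/
theorem coll_iff_of_run (h : SameColliders M₁ M₂) {m : ℕ} {x : ℕ → V} {c : V} (hadj : ∀ i < m, M₁.adj (x i) (x (i + 1)))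
    (hm : 0 < m) (hmc : M₁.adj (x m) c)
    (hinj : ∀ i ≤ m, ∀ j ≤ m, x i = x j → i = j) (h0 : ¬ M₁.adj (x 0) c) (h0c : x 0 ≠ c)
    (h1 : ∀ i, 0 < i → i < m → M₁.Coll (x (i - 1)) (x i) (x (i + 1)) ∧ M₁.Dir (x i) c)
    (h2 : ∀ i, 0 < i → i < m → M₂.Coll (x (i - 1)) (x i) (x (i + 1)) ∧ M₂.Dir (x i) c) :
    M₁.Coll (x (m - 1)) (x m) c ↔ M₂.Coll (x (m - 1)) (x m) c := by
  obtain rfl | hm2 : m = 1 ∨ 2 ≤ m := by omega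
  · exact h.unshielded _ _ _ h0c h0 (hadj 0 (by omega)) hmc
  obtain ⟨n, rfl⟩ : ∃ n, m = n + 2 := ⟨m - 2, by omega⟩
  have hne : ∀ i ≤ n + 2, x i ≠ c := by
    intro i hi
    rcases Nat.eq_zero_or_pos i with rfl | hi0
    · exact h0c
    · rcases hi.lt_or_eq with hi | rfl
      · exact (h1 i hi0 hi).2.ne
      · rintro e; rw [e] at hmc; exact M₁.irrefl hmc
  have key := h.discriminating n (fun i => if i ≤ n + 2 then x i else c) ?_ ?_ ?_ ?_ ?_
  · simpa using key
  · intro i hi j hj hij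
    split_ifs at hij with h3 h4 h4
    · exact hinj i h3 j h4 hij
    · exact absurd hij (hne i h3)
    · exact absurd hij.symm (hne j h4)
    · omega
  · intro i hi
    rw [if_pos (by omega)]
    split_ifs with h3
    · exact hadj i (by omega)
    · obtain rfl : i = n + 2 := by omega
      exact hmc
  · simpa using h0
  · intro k hk
    have := h1 (k + 1) (by omega) (by omega)
    rw [if_pos (by omega), if_pos (by omega), if_pos (by omega), if_neg (by omega)]
    exact this
  · intro k hk
    have := h2 (k + 1) (by omega) (by omega)
    rw [if_pos (by omega), if_pos (by omega), if_pos (by omega), if_neg (by omega)]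
    exact this

theorem dir_of_run (h : SameColliders M₁ M₂) {m : ℕ} {x : ℕ → V} {c : V} (hadj : ∀ i < m, M₁.adj (x i) (x (i + 1)))
    (hinj : ∀ i ≤ m, ∀ j ≤ m, x i = x j → i = j) (h0 : ¬ M₁.adj (x 0) c) (h0c : x 0 ≠ c)
    (hd : ∀ i, 0 < i → i ≤ m → M₁.Dir (x i) c)
    (hc : ∀ i, 0 < i → i < m → M₁.Coll (x (i - 1)) (x i) (x (i + 1)))
    (hl : ∀ i, 0 < i → i ≤ m → ¬ M₂.le (x i) (x (i - 1)))
    (hr : ∀ i, 0 < i → i < m → ¬ M₂.le (x i) (x (i + 1))) :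
    ∀ i, 0 < i → i ≤ m → M₂.Dir (x i) c := by
  intro i
  induction i using Nat.strong_induction_on with
  | _ i ih =>
    intro hi him
    have key := h.coll_iff_of_run (m := i) (x := x) (c := c) (fun t ht => hadj t (by omega)) hi
      (hd i hi him).1 (fun s hs t ht => hinj s (by omega) t (by omega)) h0 h0c
      (fun t ht hti => ⟨hc t ht (by omega), hd t ht (by omega)⟩)
      (fun t ht hti => ⟨⟨hl t ht (by omega), hr t ht (by omega)⟩, ih t hti ht (by omega)⟩)
    have hadj2 : M₂.adj (x i) c := (h.adj _ _).1 (hd i hi him).1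
    -- A parent of `c` is no collider before `c` in `M₁`, hence none in `M₂`; the arrowhead on its
    -- left forces the tail towards `c`.
    have hle : M₂.le (x i) c := by
      by_contra hn
      exact (key.2 ⟨hl i hi him, hn⟩).2 (hd i hi him).2.1
    refine ⟨hadj2, hle, fun hle' => ?_⟩
    have ha : M₂.adj (x (i - 1)) (x i) := by
      have := (h.adj _ _).1 (hadj (i - 1) (by omega))
      rwa [show i - 1 + 1 = i by omega] at this
    -- An undirected edge to `c` would make `x (i - 1)` adjacent to `c`. This is excluded at `i =
    -- 1`; for larger `i` the parent `x (i - 1)` of `c` would be anterior to `x i`, against `hr`.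
    have hc' := M₂.complete_adj ha (hl i hi him) hadj2 hle hle'
    obtain rfl | hi2 : i = 1 ∨ 2 ≤ i := by omega
    · exact h0 ((h.adj _ _).2 hc')
    · have h1 := (ih (i - 1) (by omega) (by omega) (by omega)).2.1
      have h2 := hr (i - 1) (by omega) (by omega)
      rw [show i - 1 + 1 = i by omega] at h2
      exact h2 (M₂.trans h1 hle')

end SameColliders

namespace TightWalk

variable {A B Z : Set V} {n : ℕ} {w : ℕ → V}

theorem reverse (W : M.TightWalk A B Z n w) : M.TightWalk A B Z n (fun i => w (n - i)) where
  adj i hi := by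
    have := M.symm (W.adj (n - (i + 1)) (by omega))
    rwa [show n - (i + 1) + 1 = n - i by omega] at this
  mem i hi := W.mem _ (by omega)
  coll i hi hz := by
    obtain ⟨h1, h2, h3⟩ := W.coll (n - i) (by omega) hz
    refine ⟨by omega, by omega, ?_⟩
    rw [show n - (i - 1) = n - i + 1 by omega, show n - (i + 1) = n - i - 1 by omega]
    exact M.coll_comm.1 h3
  inj i hi j hj hij := by
    have := W.inj (n - i) (by omega) (n - j) (by omega) hij
    omega
  chord i j hij hj ha := (W.chord (n - j) (n - i) (by omega) (by omega) (M.symm ha)).symm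
  replace k l d hkl hl hd h1 h2 h3 h4 h5 := by
    obtain ⟨h6, h7⟩ := W.replace (n - l) (n - k) d (by omega) (by omega) hd (M.symm h2) (M.symm h1)
      (M.coll_comm.1 h3) h5 h4
    refine ⟨by omega, ?_⟩
    rwa [show n - l + 1 = n - (k + 1) by omega] at h7

/-- The nodes at positions `k + 1, …, i - 1` are the maximal run of nodes of `Z` to the left of
`i` that are parents of `c`. -/
theorem exists_run (W : M.TightWalk A B Z n w) {i : ℕ} (hi : 0 < i) (c : V) :
    ∃ k < i, (∀ t, k < t → t < i → w t ∈ Z ∧ M.Dir (w t) c) ∧ ¬ (w k ∈ Z ∧ M.Dir (w k) c) := by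
  classical
  have h0 : ¬ (w 0 ∈ Z ∧ M.Dir (w 0) c) := fun h => absurd (W.coll 0 (by omega) h.1).1 (by omega)
  refine ⟨Nat.findGreatest (fun k => ¬ (w k ∈ Z ∧ M.Dir (w k) c)) (i - 1), ?_, ?_, ?_⟩
  · have := Nat.findGreatest_le (P := fun k => ¬ (w k ∈ Z ∧ M.Dir (w k) c)) (i - 1)
    omega
  · intro t ht hti
    have := Nat.findGreatest_is_greatest ht (by omega)
    simpa using this
  · exact Nat.findGreatest_spec (P := fun k => ¬ (w k ∈ Z ∧ M.Dir (w k) c)) (Nat.zero_le _) h0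

/-- Position `i` is preceded by a run of nodes of `Z`, at positions `k + 1, …, i - 1`, that are
parents of the node after it, whereas the node at position `k` is not adjacent to that node. -/
def LeftRun (M : AnteriorGraph V) (Z : Set V) (n : ℕ) (w : ℕ → V) (i k : ℕ) : Prop :=
  i < n ∧ k + 2 ≤ i ∧ (∀ t, k < t → t < i → w t ∈ Z ∧ M.Dir (w t) (w (i + 1))) ∧
    ¬ M.adj (w k) (w (i + 1))

/-- If the node before the maximal run were adjacent to `w (i + 1)`, the chord would either prolong
the run or point back to `w k`, which would make the collider `w (k + 1)` anterior to `w k`. -/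
theorem exists_leftRun (W : M.TightWalk A B Z n w) {i : ℕ} (hi : 0 < i) (hin : i < n)
    (hz : w (i - 1) ∈ Z) (hd : M.Dir (w (i - 1)) (w (i + 1))) : ∃ k, LeftRun M Z n w i k := by
  obtain ⟨k, hk, h1, h2⟩ := W.exists_run hi (w (i + 1))
  have hki : k + 2 ≤ i := by
    by_contra hc
    obtain rfl : k = i - 1 := by omega
    exact h2 ⟨hz, hd⟩
  refine ⟨k, hin, hki, h1, fun ha => ?_⟩
  rcases W.chord k (i + 1) (by omega) (by omega) ha with h3 | ⟨-, h3⟩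
  · exact h2 h3
  · obtain ⟨h4, h5⟩ := h1 (k + 1) (by omega) (by omega)
    exact (W.coll (k + 1) (by omega) h4).2.2.1 (M.trans h5.2.1 h3.2.1)

/-- The triple at position `i` is a collider in both graphs or in neither. -/
def Agree (M₁ M₂ : AnteriorGraph V) (w : ℕ → V) (i : ℕ) : Prop :=
  M₁.Coll (w (i - 1)) (w i) (w (i + 1)) ↔ M₂.Coll (w (i - 1)) (w i) (w (i + 1))

theorem agree_reverse {i : ℕ} (hi : 0 < i) (hin : i < n) :
    Agree M₁ M₂ (fun i => w (n - i)) (n - i) ↔ Agree M₁ M₂ w i := by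
  unfold Agree
  dsimp only
  rw [show n - (n - i - 1) = i + 1 by omega, show n - (n - i + 1) = i - 1 by omega,
    show n - (n - i) = i by omega, M₁.coll_comm, M₂.coll_comm]

theorem dir_of_run (h : SameColliders M₁ M₂) (W : M₁.TightWalk A B Z n w) {i k : ℕ} (hin : i ≤ n)
    {c : V}
    (h1 : ∀ t, k < t → t ≤ i → 0 < t ∧ t < n ∧ M₁.Dir (w t) c ∧
      M₁.Coll (w (t - 1)) (w t) (w (t + 1)) ∧ M₂.Coll (w (t - 1)) (w t) (w (t + 1)))
    (h2 : ¬ M₁.adj (w k) c) : ∀ t, k < t → t ≤ i → M₂.Dir (w t) c := by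
  intro t hkt hti
  have e : k + (t - k) = t := by omega
  have key := h.dir_of_run (m := i - k) (x := fun s => w (k + s)) (c := c) ?_ ?_ h2 ?_ ?_ ?_ ?_ ?_
    (t - k) (by omega) (by omega)
  · simpa only [e] using key
  · exact fun s hs => W.adj _ (by omega)
  · intro s hs s' hs' hss
    have := W.inj (k + s) (by omega) (k + s') (by omega) hss
    omega
  · rintro rfl
    obtain ⟨-, -, h3, h4, -⟩ := h1 (k + 1) (by omega) (by omega)
    exact h4.1 h3.2.1
  · exact fun s hs hs' => (h1 (k + s) (by omega) (by omega)).2.2.1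
  · intro s hs hs'
    rw [show k + (s - 1) = k + s - 1 by omega]
    exact (h1 (k + s) (by omega) (by omega)).2.2.2.1
  · intro s hs hs'
    rw [show k + (s - 1) = k + s - 1 by omega]
    exact (h1 (k + s) (by omega) (by omega)).2.2.2.2.1
  · intro s hs hs'
    exact (h1 (k + s) (by omega) (by omega)).2.2.2.2.2

/-- Agreement inside the run makes its nodes colliders in both graphs, and `dir_of_run` makes them
parents of `w (i + 1)` in both; the run is then discriminating for `w i` in both. -/
theorem agree_of_leftRun (h : SameColliders M₁ M₂) (W : M₁.TightWalk A B Z n w) {i k : ℕ}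
    (hr : LeftRun M₁ Z n w i k) (hg : ∀ t, k < t → t < i → Agree M₁ M₂ w t) :
    Agree M₁ M₂ w i := by
  obtain ⟨hin, hki, h1, h2⟩ := hr
  have hc : ∀ t, k < t → t < i → M₁.Coll (w (t - 1)) (w t) (w (t + 1)) ∧
      M₂.Coll (w (t - 1)) (w t) (w (t + 1)) := fun t ht hti => by
    have := (W.coll t (by omega) (h1 t ht hti).1).2.2
    exact ⟨this, (hg t ht hti).1 this⟩
  have hd := W.dir_of_run h (i := i - 1) (k := k) (by omega) (c := w (i + 1))
    (fun t ht hti => ⟨by omega, by omega, (h1 t ht (by omega)).2, hc t ht (by omega)⟩) h2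
  have key := h.coll_iff_of_run (m := i - k) (x := fun s => w (k + s)) (c := w (i + 1)) ?_
    (by omega) ?_ ?_ h2 ?_ ?_ ?_
  · rwa [show k + (i - k - 1) = i - 1 by omega, show k + (i - k) = i by omega] at key
  · exact fun s hs => W.adj _ (by omega)
  · rw [show k + (i - k) = i by omega]
    exact W.adj i hin
  · intro s hs s' hs' hss
    have := W.inj (k + s) (by omega) (k + s') (by omega) hss
    omega
  · intro e
    have := W.inj _ (by omega) _ (by omega) e
    omega
  · intro s hs hs'
    rw [show k + (s - 1) = k + s - 1 by omega]
    exact ⟨(hc (k + s) (by omega) (by omega)).1, (h1 (k + s) (by omega) (by omega)).2⟩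
  · intro s hs hs'
    rw [show k + (s - 1) = k + s - 1 by omega]
    exact ⟨(hc (k + s) (by omega) (by omega)).2, hd (k + s) (by omega) (by omega)⟩

/-- A shielded triple has a chord between its outer nodes, directed out of a node of `Z`; that node
begins a run on its side. -/
theorem agree_or_run (h : SameColliders M₁ M₂) (W : M₁.TightWalk A B Z n w) {i : ℕ} (hi : 0 < i)
    (hin : i < n) : Agree M₁ M₂ w i ∨ (∃ k, LeftRun M₁ Z n w i k) ∨
      ∃ k, LeftRun M₁ Z n (fun i => w (n - i)) (n - i) k := by
  have e : i - 1 + 1 = i := by omega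
  by_cases ha : M₁.adj (w (i - 1)) (w (i + 1))
  · rcases W.chord _ _ (by omega) (by omega) ha with ⟨h1, h2⟩ | ⟨h1, h2⟩
    · exact .inr (.inl (W.exists_leftRun hi hin h1 h2))
    · refine .inr (.inr (W.reverse.exists_leftRun (by omega) (by omega) ?_ ?_))
      · rwa [show n - (n - i - 1) = i + 1 by omega]
      · rwa [show n - (n - i - 1) = i + 1 by omega, show n - (n - i + 1) = i - 1 by omega]
  · refine .inl (h.unshielded _ _ _ ?_ ha ?_ (W.adj i hin))
    · intro e
      have := W.inj _ (by omega) _ (by omega) e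
      omega
    · have := W.adj (i - 1) (by omega)
      rwa [e] at this

theorem not_crossing_runs (W : M.TightWalk A B Z n w) {i j k l : ℕ}
    (hr : LeftRun M Z n w i k) (hj : j ≤ n) (hl : LeftRun M Z n (fun i => w (n - i)) (n - j) l)
    (hkj : k < j) (hji : j < i) (hil : i < n - l) : False := by
  obtain ⟨hin, hki, h1, h2⟩ := hr
  obtain ⟨hin', hki', h1', -⟩ := hl
  have hi : w i ∈ Z ∧ M.Dir (w i) (w (j - 1)) := by
    have := h1' (n - i) (by omega) (by omega)
    dsimp only at this
    rwa [show n - (n - i) = i by omega, show n - (n - j + 1) = j - 1 by omega] at this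
  obtain rfl | hk : k = j - 1 ∨ k < j - 1 := by omega
  -- The section from `w (j - 1)` to `w (i + 1)` is an inducing path between non-adjacent nodes: its
  -- inner nodes before `w i` are parents of the right end, and `w i` is a parent of the left end.
  · refine M.maximal (i + 2 - j) (fun s => w (j - 1 + s)) ?_ ?_ ?_ ?_ ?_
    · intro s hs s' hs' hss
      have := W.inj (j - 1 + s) (by omega) (j - 1 + s') (by omega) hss
      omega
    · exact fun s hs => W.adj _ (by omega)
    · intro e
      have := W.inj _ (by omega) _ (by omega) e
      omega
    · rwa [show j - 1 + (i + 2 - j) = i + 1 by omega]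
    · intro s hs hs'
      rw [show j - 1 + (s - 1) = j - 1 + s - 1 by omega, add_zero,
        show j - 1 + (i + 2 - j) = i + 1 by omega]
      obtain he | hlt : j - 1 + s = i ∨ j - 1 + s < i := by omega
      · rw [← add_assoc, he]
        exact ⟨(W.coll i (by omega) hi.1).2.2, .inl hi.2⟩
      · obtain ⟨h3, h4⟩ := h1 (j - 1 + s) (by omega) hlt
        exact ⟨(W.coll _ (by omega) h3).2.2, .inr h4⟩
  -- Here `w (j - 1)` itself belongs to the left run, so `w i` is anterior to `w (i + 1)` through
  -- it, although `w i` is a collider.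
  · exact (W.coll i (by omega) hi.1).2.2.2
      (M.trans hi.2.2.1 (h1 (j - 1) hk (by omega)).2.2.1)

theorem agree_of_leftRun_exists (h : SameColliders M₁ M₂) (W : M₁.TightWalk A B Z n w) {i k : ℕ}
    (hr : LeftRun M₁ Z n w i k) : Agree M₁ M₂ w i := by
  classical
  induction i using Nat.strong_induction_on generalizing k with
  | _ i ih =>
    by_contra hbad
    have hex : ∃ t, k < t ∧ t < i ∧ ¬ Agree M₁ M₂ w t := by
      by_contra! hc
      exact hbad (W.agree_of_leftRun h hr hc)
    obtain ⟨t, hkt, hti, hbt⟩ := hex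
    have hin := hr.1
    -- The last disagreement before `i`. It has no left run by induction, so it has a right run. If
    -- that run contains `i`, the two runs cross; otherwise it lies between `j` and `i`, where the
    -- graphs agree, and this forces agreement at `j`.
    set j := Nat.findGreatest (fun t => ¬ Agree M₁ M₂ w t) (i - 1) with hjdef
    have hj : ¬ Agree M₁ M₂ w j :=
      Nat.findGreatest_spec (P := fun t => ¬ Agree M₁ M₂ w t) (by omega : t ≤ i - 1) hbt
    have htj : t ≤ j := Nat.le_findGreatest (by omega) hbt
    have hji : j ≤ i - 1 := Nat.findGreatest_le _
    have hmax : ∀ s, j < s → s < i → Agree M₁ M₂ w s := fun s hs hsi => by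
      have := Nat.findGreatest_is_greatest hs (by omega)
      simpa using this
    rcases W.agree_or_run h (i := j) (by omega) (by omega) with h1 | ⟨k', h1⟩ | ⟨l, h1⟩
    · exact hj h1
    · exact hj (ih j (by omega) h1)
    · by_cases hil : i < n - l
      · exact W.not_crossing_runs hr (by omega) h1 (by omega) (by omega) hil
      · refine hj ((agree_reverse (by omega) (by omega)).1 (W.reverse.agree_of_leftRun h h1 ?_))
        intro s hs hs'
        have := hmax (n - s) (by omega) (by omega)
        rwa [← agree_reverse (n := n) (by omega) (by omega), show n - (n - s) = s by omega] at this

/-- On a tight walk, both graphs have the same colliders. -/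
theorem agree (h : SameColliders M₁ M₂) (W : M₁.TightWalk A B Z n w) {i : ℕ} (hi : 0 < i)
    (hin : i < n) : Agree M₁ M₂ w i := by
  rcases W.agree_or_run h hi hin with h1 | ⟨k, h1⟩ | ⟨k, h1⟩
  · exact h1
  · exact W.agree_of_leftRun_exists h h1
  · exact (agree_reverse hi hin).1 (W.reverse.agree_of_leftRun_exists h h1)

end TightWalk
end
end AnteriorGraph

/-! ### Existence of tight walks and their transfer to the other graph. -/

namespace AnteriorGraph

variable {V : Type*} {M M₁ M₂ : AnteriorGraph V} {A B Z : Set V} {n : ℕ} {w : ℕ → V}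

theorem trail_start (T : Trail M.Edge (M.Open A Z) n) {i : ℕ} (hi : i < n) :
    T.start i = T.node (i + 1) := (T.edge i hi).2.1

theorem trail_fin (T : Trail M.Edge (M.Open A Z) n) {i : ℕ} (hi : i < n) :
    T.fin i = T.node i := (T.edge i hi).2.2

theorem trail_open (T : Trail M.Edge (M.Open A Z) n) {i : ℕ} (hi : 0 < i) (hin : i < n) :
    M.Open A Z (T.node i) (T.node (i - 1)) (T.node (i + 1)) := by
  have := T.junction (i - 1) (by omega)
  rwa [trail_fin T (by omega), trail_start T (by omega), show i - 1 + 1 = i by omega] at this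

/-- Minimise first the length, then the sum of `dist` over the nodes. Each field forbids a
modification that would lower one of the two. The end nodes lie outside `Z`, so every node of `Z` on
the walk is an inner collider. -/
theorem exists_tightWalk {a b : V} (hab : a ≠ b) (ha : a ∈ A) (hb : b ∈ A) (haZ : a ∉ Z)
    (hbZ : b ∉ Z)
    (h : ∃ p q n k, Chain M.Edge (M.Open A Z) (M.dist B) a p b q n k) :
    ∃ n w, w 0 = a ∧ w n = b ∧ M.TightWalk A B Z n w := by
  classical
  have h1 : ∃ n, ∃ k p q, Chain M.Edge (M.Open A Z) (M.dist B) a p b q n k := by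
    obtain ⟨p, q, n, k, h⟩ := h
    exact ⟨n, k, p, q, h⟩
  obtain ⟨n, hn⟩ : ∃ n, n = Nat.find h1 := ⟨_, rfl⟩
  have h2 : ∃ k p q, Chain M.Edge (M.Open A Z) (M.dist B) a p b q n k := hn ▸ Nat.find_spec h1
  have min1 : ∀ {m k p q}, Chain M.Edge (M.Open A Z) (M.dist B) a p b q m k → n ≤ m :=
    fun {m k p q} hc => hn ▸ Nat.find_min' h1 ⟨k, p, q, hc⟩
  obtain ⟨p, q, hc⟩ := Nat.find_spec h2
  have min2 : ∀ {k p q}, Chain M.Edge (M.Open A Z) (M.dist B) a p b q n k → Nat.find h2 ≤ k :=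
    fun {k p q} hc => Nat.find_min' h2 ⟨p, q, hc⟩
  obtain ⟨T, h0, -, hnb, -, hk⟩ := hc.exists_trail
  have coll : ∀ i ≤ n, T.node i ∈ Z →
      0 < i ∧ i < n ∧ M.Coll (T.node (i - 1)) (T.node i) (T.node (i + 1)) := by
    intro i hi hz
    rcases Nat.eq_zero_or_pos i with rfl | hi0
    · rw [h0] at hz; exact absurd hz haZ
    rcases hi.lt_or_eq with hi1 | rfl
    · exact ⟨hi0, hi1, (trail_open T hi0 hi1).2 hz⟩
    · rw [hnb] at hz; exact absurd hz hbZ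
  have adj : ∀ i < n, M.adj (T.node i) (T.node (i + 1)) := fun i hi => (T.edge i hi).1
  have mem : ∀ i ≤ n, T.node i ∈ A := by
    intro i hi
    rcases Nat.eq_zero_or_pos i with rfl | hi0
    · rwa [h0]
    rcases hi.lt_or_eq with hi1 | rfl
    · exact (trail_open T hi0 hi1).1
    · rwa [hnb]
  have inj' : ∀ i j, i < j → j ≤ n → T.node i ≠ T.node j := by
    intro i j hij hj heq
    have hne : 0 < i ∨ j < n := by
      by_contra hcon
      obtain rfl : i = 0 := by omega
      obtain rfl : j = n := by omega
      exact hab (h0 ▸ hnb ▸ heq)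
    obtain ⟨p', q', k', hc'⟩ := T.excise (M.dist B) hij hj hne heq (fun hi hjn => by
      rw [trail_fin T (by omega), trail_start T (by omega)]
      refine ⟨mem i (by omega), fun hz => ⟨(coll i (by omega) hz).2.2.1, ?_⟩⟩
      rw [heq] at hz ⊢
      exact (coll j hj hz).2.2.2)
    rw [h0, hnb] at hc'
    have := min1 hc'
    omega
  have shortcut : ∀ i j, i + 2 ≤ j → j ≤ n → M.adj (T.node i) (T.node j) →
      (T.node i ∈ Z → ¬ M.le (T.node i) (T.node j)) →
      (T.node j ∈ Z → ¬ M.le (T.node j) (T.node i)) → False := by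
    intro i j hij hj ha' h3 h4
    obtain ⟨p', q', hc'⟩ := T.splice (M.dist B) (i := i) (j := j) (by omega) hj
      (p := T.node j) (q := T.node i) (.single ⟨ha', rfl, rfl⟩)
      (fun hi => by
        rw [trail_fin T (by omega)]
        exact ⟨mem i (by omega), fun hz => ⟨(coll i (by omega) hz).2.2.1, h3 hz⟩⟩)
      (fun hjn => by
        rw [trail_start T (by omega)]
        exact ⟨mem j (by omega), fun hz => ⟨h4 hz, (coll j (by omega) hz).2.2.2⟩⟩)
    rw [h0, hnb] at hc'
    have := min1 hc'
    omega
  refine ⟨n, T.node, h0, hnb, adj, mem, coll, ?_, ?_, ?_⟩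
  · intro i hi j hj hij
    by_contra hne
    rcases Nat.lt_or_gt_of_ne hne with hlt | hlt
    · exact inj' i j hlt hj hij
    · exact inj' j i hlt hi hij.symm
  · intro i j hij hj ha'
    by_contra! hcon
    refine shortcut i j hij hj ha' (fun hz hle => ?_) (fun hz hle => ?_)
    · have hle' : M.le (T.node j) (T.node i) := by
        by_contra hn; exact hcon.1 hz ⟨ha', hle, hn⟩
      -- An undirected chord at the collider `T.node i` gives, by completeness, a chord from its
      -- predecessor. This one is a legal shortcut: a tail at either end that blocked it would give
      -- a tail at a collider by transitivity.
      obtain ⟨hi0, hin, hcl⟩ := coll i (by omega) hz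
      have hadj := adj (i - 1) (by omega)
      rw [show i - 1 + 1 = i by omega] at hadj
      refine shortcut (i - 1) j (by omega) hj (M.complete_adj hadj hcl.1 ha' hle hle')
        (fun hz' hl => ?_) (fun hz' hl => hcl.1 (M.trans hle hl))
      have := (coll (i - 1) (by omega) hz').2.2.2
      rw [show i - 1 + 1 = i by omega] at this
      exact this (M.trans hl hle')
    · have hle' : M.le (T.node i) (T.node j) := by
        by_contra hn; exact hcon.2 hz ⟨M.symm ha', hle, hn⟩
      obtain ⟨hi0, hin, hcl⟩ := coll j hj hz
      have hadj := adj j (by omega)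
      refine shortcut i (j + 1) (by omega) (by omega)
        (M.symm (M.complete_adj (M.symm hadj) hcl.2 (M.symm ha') hle hle'))
        (fun hz' hl => hcl.2 (M.trans hle hl)) (fun hz' hl => ?_)
      have := (coll (j + 1) (by omega) hz').2.2.1
      rw [show j + 1 - 1 = j by omega] at this
      exact this (M.trans hl hle')
  · intro k l d hkl hl hd h3 h4 h5 h6 h7
    obtain ⟨p', q', hc'⟩ := T.splice (M.dist B) (i := k) (j := l) (by omega) hl
      (p := d) (q := d) (.cons (b := d) (q := T.node k) (r := T.node l) ⟨h3, rfl, rfl⟩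
        ⟨hd, fun _ => h5⟩ (.single ⟨h4, rfl, rfl⟩))
      (fun hi => by
        rw [trail_fin T (by omega)]
        exact ⟨mem k (by omega), fun hz => ⟨(coll k (by omega) hz).2.2.1, h6 hz⟩⟩)
      (fun hjn => by
        rw [trail_start T (by omega)]
        exact ⟨mem l (by omega), fun hz => ⟨h7 hz, (coll l (by omega) hz).2.2.2⟩⟩)
    rw [h0, hnb] at hc'
    have := min1 hc'
    obtain rfl : l = k + 2 := by omega
    refine ⟨rfl, ?_⟩
    have hw := min2 (hc'.congr_nat (by omega) rfl)
    rw [hk, ← Finset.sum_range_add_sum_Ico _ hl, Finset.sum_range_succ, Finset.sum_range_succ,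
      show k + 1 + 1 = k + 2 from rfl] at hw
    omega

namespace TightWalk

/-- The next node `d` on a shortest anterior walk from a collider to `B` is a child of the collider
in both graphs. -/
theorem dir_of_dist_lt (h : SameColliders M₁ M₂) (W : M₁.TightWalk A B Z n w) {i : ℕ} (hi : 0 < i)
    (hin : i < n) (hc : M₁.Coll (w (i - 1)) (w i) (w (i + 1))) {d : V} (hd : d ∈ A)
    (hadj : M₁.adj (w i) d) (hle : M₁.le (w i) d) (hlt : M₁.dist B d < M₁.dist B (w i)) :
    M₁.Dir (w i) d ∧ M₂.Dir (w i) d := by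
  have e : i - 1 + 1 = i := by omega
  have hadjl := W.adj (i - 1) (by omega)
  rw [e] at hadjl
  have hadjr := W.adj i hin
  have hdir : M₁.Dir (w i) d := by
    refine ⟨hadj, hle, fun hle' => ?_⟩
    -- If the edge were undirected, completeness would make `d` adjacent to both neighbours of `w
    -- i`, and `d` could take its place at smaller distance.
    have key := W.replace (i - 1) (i + 1) d (by omega) (by omega) hd
      (M₁.complete_adj hadjl hc.1 hadj hle hle')
      (M₁.symm (M₁.complete_adj (M₁.symm hadjr) hc.2 hadj hle hle'))
      ⟨fun hl => hc.1 (M₁.trans hle hl), fun hl => hc.2 (M₁.trans hle hl)⟩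
      (fun hz hl => by
        have := (W.coll (i - 1) (by omega) hz).2.2.2
        rw [e] at this
        exact this (M₁.trans hl hle'))
      (fun hz hl => by
        have := (W.coll (i + 1) (by omega) hz).2.2.1
        rw [show i + 1 - 1 = i by omega] at this
        exact this (M₁.trans hl hle'))
    rw [e] at key
    omega
  refine ⟨hdir, ?_⟩
  have hcoll : ∀ t, t ≤ n → w t ∈ Z ∨ t = i → 0 < t ∧ t < n ∧
      M₁.Coll (w (t - 1)) (w t) (w (t + 1)) := by
    rintro t htn (hz | rfl)
    · exact W.coll t htn hz
    · exact ⟨hi, hin, hc⟩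
  obtain ⟨k, hk, hk1, hk2⟩ := W.exists_run hi d
  obtain ⟨l', hl', hl1', hl2'⟩ := W.reverse.exists_run (i := n - i) (by omega) d
  obtain ⟨l, rfl, hln⟩ : ∃ l, l' = n - l ∧ l ≤ n := ⟨n - l', by omega, by omega⟩
  have hl1 : ∀ t, i < t → t < l → w t ∈ Z ∧ M₁.Dir (w t) d := by
    intro t hit htl
    have := hl1' (n - t) (by omega) (by omega)
    rwa [show n - (n - t) = t by omega] at this
  have hl2 : ¬ (w l ∈ Z ∧ M₁.Dir (w l) d) := by
    rwa [show n - (n - l) = l by omega] at hl2'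
  have hkd : ∀ t, k < t → t < l → (w t ∈ Z ∨ t = i) ∧ M₁.Dir (w t) d := by
    intro t hkt htl
    rcases Nat.lt_trichotomy t i with h1 | rfl | h1
    · exact ⟨.inl (hk1 t hkt h1).1, (hk1 t hkt h1).2⟩
    · exact ⟨.inr rfl, hdir⟩
    · exact ⟨.inl (hl1 t h1 htl).1, (hl1 t h1 htl).2⟩
  by_cases hak : M₁.adj (w k) d
  · by_cases hal : M₁.adj (w l) d
    · have hck : ¬ M₁.le d (w k) := fun hl => by
        obtain ⟨h1, h2⟩ := hkd (k + 1) (by omega) (by omega)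
        exact (hcoll _ (by omega) h1).2.2.1 (M₁.trans h2.2.1 hl)
      have hcl : ¬ M₁.le d (w l) := fun hl => by
        obtain ⟨h1, h2⟩ := hkd (l - 1) (by omega) (by omega)
        have := (hcoll _ (by omega) h1).2.2.2
        rw [show l - 1 + 1 = l by omega] at this
        exact this (M₁.trans h2.2.1 hl)
      -- With both ends adjacent to `d`, detouring through `d` as a collider would shorten the walk
      -- or bring it closer to `B`. Hence one end is not adjacent to `d`, and `dir_of_run` applies
      -- from that end up to `i`.
      have key := W.replace k l d (by omega) hln hd hak (M₁.symm hal) ⟨hck, hcl⟩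
        (fun hz hl => hk2 ⟨hz, hak, hl, hck⟩) (fun hz hl => hl2 ⟨hz, hal, hl, hcl⟩)
      rw [show k + 1 = i by omega] at key
      omega
    · have key := W.reverse.dir_of_run h (i := n - i) (k := n - l) (by omega) (c := d) ?_ ?_
        (n - i) (by omega) le_rfl
      · rwa [show n - (n - i) = i by omega] at key
      · intro t ht ht'
        obtain ⟨h1, h2⟩ := hkd (n - t) (by omega) (by omega)
        have h3 := (hcoll _ (by omega) h1).2.2
        have h4 := (W.agree h (by omega) (by omega)).1 h3
        rw [show n - t - 1 = n - (t + 1) by omega] at h3 h4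
        refine ⟨by omega, by omega, h2, ?_, ?_⟩
        · rw [show n - (t - 1) = n - t + 1 by omega]
          exact M₁.coll_comm.1 h3
        · rw [show n - (t - 1) = n - t + 1 by omega]
          exact M₂.coll_comm.1 h4
      · rwa [show n - (n - l) = l by omega]
  · refine W.dir_of_run h (i := i) (k := k) (by omega) (c := d) ?_ hak i hk le_rfl
    intro t ht ht'
    obtain ⟨h1, h2⟩ := hkd t ht (by omega)
    have h3 := (hcoll _ (by omega) h1).2.2
    exact ⟨by omega, by omega, h2, h3, (W.agree h (by omega) (by omega)).1 h3⟩

end TightWalk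

/-- A shortest anterior walk has no chord from `y` to the node after `d`, so `(y, d, d')` is
unshielded with `y → d` in both graphs. Being a non-collider in both and completeness force `d → d'`
in both; this repeats until `B` is reached. -/
theorem SameColliders.mem_of_dir (h : SameColliders M₁ M₂) {A₂ : Set V} (hB : B ⊆ A₂)
    (hA₂ : ∀ x y, M₂.adj x y → M₂.le x y → y ∈ A₂ → x ∈ A₂) (r : ℕ) :
    ∀ y d, M₁.Dir y d → M₂.Dir y d → (∀ s ≤ r, ¬ M₁.Reaches B s y) → M₁.Reaches B r d →
      d ∈ A₂ := by
  induction r with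
  | zero => exact fun y d _ _ _ hd => hB hd
  | succ r ih =>
    rintro y d h1 h2 hy ⟨d', ha, hle, hr⟩
    have hne : y ≠ d' := by rintro rfl; exact hy r (by omega) hr
    have hyd : ¬ M₁.adj y d' := fun h3 => hy (r + 1) le_rfl ⟨d', h3, M₁.trans h1.2.1 hle, hr⟩
    have hdir : M₁.Dir d d' :=
      ⟨ha, hle, fun hl => hyd (M₁.complete_adj h1.1 h1.2.2 ha hle hl)⟩
    have key := h.unshielded y d d' hne hyd h1.1 ha
    have hle2 : M₂.le d d' := by
      by_contra hn; exact (key.2 ⟨h2.2.2, hn⟩).2 hle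
    have ha2 := (h.adj _ _).1 ha
    have hdir2 : M₂.Dir d d' :=
      ⟨ha2, hle2, fun hl => hyd ((h.adj _ _).2 (M₂.complete_adj h2.1 h2.2.2 ha2 hle2 hl))⟩
    exact hA₂ _ _ ha2 hle2 (ih d d' hdir hdir2
      (fun s hs hrs => hy (s + 1) (by omega) ⟨d, h1.1, h1.2.1, hrs⟩) hr)

namespace TightWalk

theorem coll_mem (h : SameColliders M₁ M₂) (W : M₁.TightWalk A B Z n w) {A₂ : Set V}
    (hB₁ : B ⊆ A) (hB : B ⊆ A₂) (hA : ∀ x y, M₁.adj x y → M₁.le x y → y ∈ A → x ∈ A)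
    (hA₂ : ∀ x y, M₂.adj x y → M₂.le x y → y ∈ A₂ → x ∈ A₂)
    (hr : ∀ x u, x ∈ A → ¬ M₁.le x u → ∃ r, M₁.Reaches B r x) {i : ℕ} (hi : 0 < i)
    (hin : i < n) (hc : M₁.Coll (w (i - 1)) (w i) (w (i + 1))) : w i ∈ A₂ := by
  -- `dist` is `0` also where `B` cannot be reached, so reachability has to be secured before `dist`
  -- is used.
  obtain ⟨r, hr⟩ := hr (w i) _ (W.mem i (by omega)) hc.1
  have hr' := M₁.reaches_dist hr
  obtain hd0 | ⟨s, hs⟩ : M₁.dist B (w i) = 0 ∨ ∃ s, M₁.dist B (w i) = s + 1 := by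
    rcases M₁.dist B (w i) with _ | s
    · exact .inl rfl
    · exact .inr ⟨s, rfl⟩
  · rw [hd0] at hr'; exact hB hr'
  · rw [hs] at hr'
    obtain ⟨d, h1, h2, h3⟩ := hr'
    have h4 := M₁.dist_le h3
    obtain ⟨h5, h6⟩ := W.dir_of_dist_lt h hi hin hc (M₁.mem_of_reaches hB₁ hA h3) h1 h2 (by omega)
    refine hA₂ _ _ h6.1 h6.2.1 (h.mem_of_dir hB hA₂ s _ _ h5 h6 (fun t ht ht' => ?_) h3)
    have := M₁.dist_le ht'
    omega

/-- The nodes `t` and `t + 1` of a tight walk are not of the form `∗→ w t - w (t + 1) ←∗` in a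
graph with the same colliders. -/
theorem not_arrow_undir_arrow (h : SameColliders M₁ M₂) (W : M₁.TightWalk A B Z n w) {t : ℕ}
    (ht : 0 < t) (htn : t + 2 ≤ n) (h1 : ¬ M₂.le (w t) (w (t - 1)))
    (h2 : M₂.le (w t) (w (t + 1))) (h3 : M₂.le (w (t + 1)) (w t))
    (h4 : ¬ M₂.le (w (t + 1)) (w (t + 2))) : False := by
  have e : t - 1 + 1 = t := by omega
  have adj2 : ∀ i < n, M₂.adj (w i) (w (i + 1)) := fun i hi => (h.adj _ _).1 (W.adj i hi)
  have a1 := adj2 (t - 1) (by omega)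
  rw [e] at a1
  have a2 := adj2 t (by omega)
  have a3 := adj2 (t + 1) (by omega)
  have c1 := (h.adj _ _).2 (M₂.complete_adj a1 h1 a2 h2 h3)
  have c2 := (h.adj _ _).2 (M₂.complete_adj (M₂.symm a3) h4 (M₂.symm a2) h3 h2)
  have n1 : ¬ M₁.Coll (w (t - 1)) (w t) (w (t + 1)) := fun hc =>
    ((W.agree h ht (by omega)).1 hc).2 h2
  have n2 : ¬ M₁.Coll (w t) (w (t + 1)) (w (t + 2)) := fun hc =>
    ((W.agree h (i := t + 1) (by omega) (by omega)).1 hc).1 h3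
  -- Completeness in `M₂` shields both triples. Their middle nodes are non-colliders in `M₁`, hence
  -- outside `Z`, so both chords come from the outer nodes, which are colliders in `Z`.
  have d1 : w (t - 1) ∈ Z ∧ M₁.Dir (w (t - 1)) (w (t + 1)) := by
    rcases W.chord _ _ (by omega) (by omega) c1 with h5 | ⟨h5, -⟩
    · exact h5
    · exact absurd (W.coll _ (by omega) h5).2.2 n2
  have d2 : w (t + 2) ∈ Z ∧ M₁.Dir (w (t + 2)) (w t) := by
    rcases W.chord t (t + 2) (by omega) (by omega) (M₁.symm c2) with ⟨h5, -⟩ | h5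
    · exact absurd (W.coll _ (by omega) h5).2.2 n1
    · exact h5
  have l1 := (W.coll (t - 1) (by omega) d1.1).2.2.2
  rw [e] at l1
  have l2 := (W.coll (t + 2) (by omega) d2.1).2.2.1
  rw [show t + 2 - 1 = t + 1 by omega] at l2
  unfold Coll at n1 n2
  push Not at n1 n2
  have hbc : M₁.le (w t) (w (t - 1)) → M₁.le (w t) (w (t + 1)) := fun hl => M₁.trans hl d1.2.2.1
  have hcb : M₁.le (w (t + 1)) (w (t + 2)) → M₁.le (w (t + 1)) (w t) :=
    fun hl => M₁.trans hl d2.2.2.1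
  -- A tail of a middle node towards its outer neighbour yields, through the chord, a tail towards
  -- the other middle node. So the middle edge is undirected in `M₁`, and `w (t - 1)` becomes
  -- anterior to `w t`, although it is a collider.
  have h6 : M₁.le (w t) (w (t + 1)) := by
    by_cases hl : M₁.le (w t) (w (t - 1))
    · exact hbc hl
    · exact n1 hl
  have h7 : M₁.le (w (t + 1)) (w t) := by
    by_cases hl : M₁.le (w (t + 1)) (w t)
    · exact hl
    · exact hcb (n2 hl)
  exact l1 (M₁.trans d1.2.2.1 h7)

/-- A tight walk stays inside the anterior set in a graph with the same colliders. -/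
theorem mem_of_sameColliders (h : SameColliders M₁ M₂) (W : M₁.TightWalk A B Z n w) {A₂ : Set V}
    (hA₂ : ∀ x y, M₂.adj x y → M₂.le x y → y ∈ A₂ → x ∈ A₂) (h0 : w 0 ∈ A₂) (hn : w n ∈ A₂)
    (hc : ∀ i, 0 < i → i < n → M₁.Coll (w (i - 1)) (w i) (w (i + 1)) → w i ∈ A₂) :
    ∀ i ≤ n, w i ∈ A₂ := by
  have adj2 : ∀ i < n, M₂.adj (w i) (w (i + 1)) := fun i hi => (h.adj _ _).1 (W.adj i hi)
  have hc2 : ∀ i, 0 < i → i < n → M₂.Coll (w (i - 1)) (w i) (w (i + 1)) → w i ∈ A₂ :=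
    fun i hi hin hcl => hc i hi hin ((W.agree h hi hin).2 hcl)
  -- From an arrowhead on its left, a node is a collider or has a tail to its right. Membership is
  -- inherited from the right, and after at most two edges there is again an arrowhead or the end of
  -- the walk.
  have right : ∀ m t, n = t + m → 0 < t → t < n → ¬ M₂.le (w t) (w (t - 1)) → w t ∈ A₂ := by
    intro m
    induction m using Nat.strong_induction_on with
    | _ m ih =>
      intro t hm ht htn hl
      by_cases hl1 : M₂.le (w t) (w (t + 1))
      swap
      · exact hc2 t ht htn ⟨hl, hl1⟩
      refine hA₂ _ _ (adj2 t htn) hl1 ?_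
      obtain he | hlt : t + 1 = n ∨ t + 1 < n := by omega
      · rwa [he]
      by_cases hl2 : M₂.le (w (t + 1)) (w t)
      swap
      · exact ih (m - 1) (by omega) (t + 1) (by omega) (by omega) hlt hl2
      by_cases hl3 : M₂.le (w (t + 1)) (w (t + 2))
      swap
      · exact (W.not_arrow_undir_arrow h ht (by omega) hl hl1 hl2 hl3).elim
      refine hA₂ _ _ (adj2 (t + 1) hlt) hl3 ?_
      obtain he | hlt' : t + 2 = n ∨ t + 2 < n := by omega
      · rwa [show t + 1 + 1 = n by omega]
      by_cases hl4 : M₂.le (w (t + 2)) (w (t + 1))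
      swap
      · exact ih (m - 2) (by omega) (t + 2) (by omega) (by omega) hlt' hl4
      exfalso
      have a1 := adj2 (t - 1) (by omega)
      rw [show t - 1 + 1 = t by omega] at a1
      have a2 := adj2 t (by omega)
      have a3 := adj2 (t + 1) (by omega)
      have h5 := M₂.complete_adj a1 hl a2 hl1 hl2
      have hl5 : ¬ M₂.le (w (t + 1)) (w (t - 1)) := fun hl5 => hl (M₂.trans hl1 hl5)
      have hne : w t ≠ w (t + 2) := fun e => by
        have := W.inj _ (by omega) _ (by omega) e
        omega
      -- Two consecutive undirected edges after an arrowhead create a chord from `w t` to `w (t +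
      -- 2)`. One of these would be in `Z`, hence a collider in both graphs, but each has a tail
      -- towards `w (t + 1)` in `M₂`.
      have h6 := M₂.complete_nbh h5 hl5 (M₂.symm a2) hl2 hl1 a3 hl3 hl4 hne
      rcases W.chord t (t + 2) le_rfl (by omega) ((h.adj _ _).2 h6) with ⟨h7, -⟩ | ⟨h7, -⟩
      · exact ((W.agree h ht htn).1 (W.coll _ (by omega) h7).2.2).2 hl1
      · exact ((W.agree h (i := t + 2) (by omega) hlt').1 (W.coll _ (by omega) h7).2.2).1 hl4
  intro i
  induction i with
  | zero => exact fun _ => h0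
  | succ i ih =>
    intro hi
    rcases hi.lt_or_eq with hlt | he
    swap
    · rwa [he]
    by_cases hl : M₂.le (w (i + 1)) (w i)
    · exact hA₂ _ _ (M₂.symm (adj2 i (by omega))) hl (ih (by omega))
    · exact right (n - (i + 1)) (i + 1) (by omega) (by omega) hlt hl

end TightWalk

/-- Open walks can be transferred between graphs with the same adjacencies, unshielded colliders and
colliders on discriminating paths. -/
theorem SameColliders.exists_chain (h : SameColliders M₁ M₂) {A₁ A₂ : Set V} {a b : V} (hab : a ≠ b)
    (haB : a ∈ B) (hbB : b ∈ B) (haZ : a ∉ Z) (hbZ : b ∉ Z) (hB₁ : B ⊆ A₁) (hB₂ : B ⊆ A₂)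
    (hA₁ : ∀ x y, M₁.adj x y → M₁.le x y → y ∈ A₁ → x ∈ A₁)
    (hA₂ : ∀ x y, M₂.adj x y → M₂.le x y → y ∈ A₂ → x ∈ A₂)
    (hr : ∀ x u, x ∈ A₁ → ¬ M₁.le x u → ∃ r, M₁.Reaches B r x)
    (hch : ∃ p q n k, Chain M₁.Edge (M₁.Open A₁ Z) (M₁.dist B) a p b q n k) :
    ∃ (n : ℕ) (w : ℕ → V), w 0 = a ∧ w n = b ∧ (∀ i < n, M₂.adj (w i) (w (i + 1))) ∧
      (∀ i ≤ n, w i ∈ A₂) ∧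
      ∀ i, 0 < i → i < n → w i ∈ Z → M₂.Coll (w (i - 1)) (w i) (w (i + 1)) := by
  obtain ⟨n, w, h0, hn, W⟩ := exists_tightWalk hab (hB₁ haB) (hB₁ hbB) haZ hbZ hch
  refine ⟨n, w, h0, hn, fun i hi => (h.adj _ _).1 (W.adj i hi),
    W.mem_of_sameColliders h hA₂ (h0 ▸ hB₂ haB) (hn ▸ hB₂ hbB)
    (fun i hi hin hc => W.coll_mem h hB₁ hB₂ hA₁ hA₂ hr hi hin hc), fun i hi hin hz =>
    (W.agree h hi hin).1 (W.coll i (by omega) hz).2.2⟩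

end AnteriorGraph

/-! ### Walks of a mixed graph as labelled chains. -/

namespace MixedGraph

variable {W : Type*} (G : MixedGraph W)

/-- The edges of a mixed graph, labelled at each end with the mark and with the statement that the
edge is not directed from that end to another strongly connected component. -/
def LEdge (x : W) (p q : EdgeMark × Prop) (y : W) : Prop :=
  G.edge x p.1 q.1 y ∧ (p.2 ↔ (p.1 = .tail → y ∈ G.sc x)) ∧ (q.2 ↔ (q.1 = .tail → x ∈ G.sc y))

/-- Colliders are in `T`, and blockable non-colliders are not in `Z`. -/
def Passes (T Z : Set W) (x : W) (q r : EdgeMark × Prop) : Prop :=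
  (q.1 = .arrow → r.1 = .arrow → x ∈ T) ∧ (x ∈ Z → q.2 ∧ r.2)

variable {G}

theorem Passes.mono {T T' Z Z' : Set W} (hT : T ⊆ T') (hZ : Z' ⊆ Z) {x : W} {q r : EdgeMark × Prop}
    (h : Passes T Z x q r) : Passes T' Z' x q r :=
  ⟨fun h1 h2 => hT (h.1 h1 h2), fun h1 => h.2 (hZ h1)⟩

theorem Passes.symm {T Z : Set W} {x : W} {q r : EdgeMark × Prop} (h : Passes T Z x q r) :
    Passes T Z x r q := ⟨fun h1 h2 => h.1 h2 h1, fun h1 => (h.2 h1).symm⟩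

theorem LEdge.symm {x y : W} {p q : EdgeMark × Prop} (h : G.LEdge x p q y) : G.LEdge y q p x :=
  ⟨G.symm _ _ _ _ h.1, h.2.2, h.2.1⟩

theorem chain_reverse {T Z : Set W} {a b : W} {p q : EdgeMark × Prop} {n k : ℕ}
    (h : Chain G.LEdge (Passes T Z) (fun _ => 0) a p b q n k) :
    ∃ k', Chain G.LEdge (Passes T Z) (fun _ => 0) b q a p n k' :=
  Chain.reverse (E := G.LEdge) (J := Passes T Z) (fun _ _ _ _ h => h.symm) (fun _ _ _ h => h.symm) h

theorem subset_anc (A : Set W) : A ⊆ G.anc A := fun x hx => ⟨x, hx, .refl⟩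

theorem mem_anc_of_dir {A : Set W} {x y : W} (h : G.Dir x y) (hy : y ∈ G.anc A) : x ∈ G.anc A := by
  obtain ⟨v, hv, h'⟩ := hy
  exact ⟨v, hv, .head h h'⟩

theorem mem_anc_of_reaches {A : Set W} {x y : W} (h : Relation.ReflTransGen G.Dir x y)
    (hy : y ∈ G.anc A) : x ∈ G.anc A := by
  obtain ⟨v, hv, h'⟩ := hy
  exact ⟨v, hv, h.trans h'⟩

theorem anc_subset {A B : Set W} (h : A ⊆ G.anc B) : G.anc A ⊆ G.anc B := by
  rintro x ⟨v, hv, h'⟩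
  exact mem_anc_of_reaches h' (h hv)

theorem anc_mono {A B : Set W} (h : A ⊆ B) : G.anc A ⊆ G.anc B :=
  anc_subset (h.trans (subset_anc B))

theorem mem_anc_union {A B : Set W} {x : W} (h : x ∈ G.anc (A ∪ B)) : x ∈ G.anc A ∨ x ∈ G.anc B := by
  obtain ⟨v, hv | hv, h'⟩ := h
  · exact .inl ⟨v, hv, h'⟩
  · exact .inr ⟨v, hv, h'⟩

theorem _root_.EdgeMark.eq_arrow_of_ne {m : EdgeMark} (h : m ≠ .tail) : m = .arrow := by
  cases m
  · exact absurd rfl h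
  · rfl

/-- If the end nodes and the colliders of a walk are in an ancestral set, then so are all nodes. -/
theorem trail_mem {J : W → EdgeMark × Prop → EdgeMark × Prop → Prop} {n : ℕ} {A : Set W}
    (T : Trail G.LEdge J n) (hG : ∀ a b, ¬ G.edge a .tail .tail b)
    (hA : ∀ x y, G.Dir x y → y ∈ A → x ∈ A)
    (hJ : ∀ x q r, J x q r → q.1 = .arrow → r.1 = .arrow → x ∈ A)
    (h0 : T.node 0 ∈ A) (hn : T.node n ∈ A) : ∀ i ≤ n, T.node i ∈ A := by
  have right : ∀ m i, n = i + 1 + m → i < n → (T.fin i).1 = .arrow → T.node (i + 1) ∈ A := by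
    intro m
    induction m with
    | zero => intro i hi hin _; rwa [show i + 1 = n from hi.symm]
    | succ m ih =>
      intro i hi hin harr
      have hj := T.junction i (by omega)
      cases hm : (T.start (i + 1)).1 with
      | arrow => exact hJ _ _ _ hj harr hm
      | tail =>
        have he := (T.edge (i + 1) (by omega)).1
        rw [hm] at he
        have hf : (T.fin (i + 1)).1 = .arrow :=
          EdgeMark.eq_arrow_of_ne fun h => hG _ _ (h ▸ he)
        rw [hf] at he
        exact hA _ _ he (ih (i + 1) (by omega) (by omega) hf)
  intro i
  induction i with
  | zero => exact fun _ => h0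
  | succ i ih =>
    intro hi
    cases hm : (T.fin i).1 with
    | arrow => exact right (n - (i + 1)) i (by omega) (by omega) hm
    | tail =>
      have he := (T.edge i (by omega)).1
      rw [hm] at he
      have hf : (T.start i).1 = .arrow :=
        EdgeMark.eq_arrow_of_ne fun h => hG _ _ (h ▸ he)
      rw [hf] at he
      exact hA _ _ (G.symm _ _ _ _ he) (ih (by omega))

/-- The trail underlying a walk. -/
def Walk.trail (π : G.Walk) (J : W → EdgeMark × Prop → EdgeMark × Prop → Prop)
    (hJ : ∀ i, i + 1 < π.length → J (π.node (i + 1))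
      (π.endMark i, π.endMark i = .tail → π.node i ∈ G.sc (π.node (i + 1)))
      (π.startMark (i + 1), π.startMark (i + 1) = .tail →
        π.node (i + 1 + 1) ∈ G.sc (π.node (i + 1)))) : Trail G.LEdge J π.length where
  node := π.node
  start i := (π.startMark i, π.startMark i = .tail → π.node (i + 1) ∈ G.sc (π.node i))
  fin i := (π.endMark i, π.endMark i = .tail → π.node i ∈ G.sc (π.node (i + 1)))
  edge i hi := ⟨π.isEdge i hi, Iff.rfl, Iff.rfl⟩
  junction := hJ

/-- The walk underlying a trail. -/
def trailWalk {J : W → EdgeMark × Prop → EdgeMark × Prop → Prop} {n : ℕ}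
    (T : Trail G.LEdge J n) : G.Walk where
  length := n
  node := T.node
  startMark i := (T.start i).1
  endMark i := (T.fin i).1
  isEdge i hi := (T.edge i hi).1

theorem trailWalk_isUnblockable {J : W → EdgeMark × Prop → EdgeMark × Prop → Prop} {n : ℕ}
    (T : Trail G.LEdge J n) {k : ℕ} (hk : (trailWalk T).IsInner k)
    (hc : (trailWalk T).IsNonCollider k) :
    (trailWalk T).IsUnblockable k ↔ (T.fin (k - 1)).2 ∧ (T.start k).2 := by
  have hk' : 0 < k ∧ k < n := hk
  have h1 := (T.edge (k - 1) (by omega)).2.2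
  have h2 := (T.edge k hk'.2).2.1
  rw [show k - 1 + 1 = k by omega] at h1
  rw [h1, h2]
  exact ⟨fun h => h.2.2, fun h => ⟨hk, hc, h⟩⟩

theorem trail_junction {J : W → EdgeMark × Prop → EdgeMark × Prop → Prop} {n : ℕ}
    (T : Trail G.LEdge J n) {k : ℕ} (hk : 0 < k) (hkn : k < n) :
    J (T.node k) (T.fin (k - 1)) (T.start k) := by
  have := T.junction (k - 1) (by omega)
  rwa [show k - 1 + 1 = k by omega] at this

theorem trailWalk_isSigmaInducing {S : Set W} {n : ℕ} {a b : W}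
    (T : Trail G.LEdge (Passes (G.anc ({a, b} ∪ S)) Set.univ) n) (ha : T.node 0 = a)
    (hb : T.node n = b) : (trailWalk T).IsSigmaInducing S := by
  constructor
  · rintro k ⟨⟨hk, hkn⟩, h1, h2⟩
    change T.node k ∈ G.anc ({T.node 0, T.node n} ∪ S)
    rw [ha, hb]
    exact (trail_junction T hk hkn).1 h1 h2
  · intro k hk hc
    exact (trailWalk_isUnblockable T hk hc).2 ((trail_junction T hk.1 hk.2).2 trivial)

theorem trailWalk_not_isSigmaBlocked {Z : Set W} {n : ℕ} (T : Trail G.LEdge (Passes (G.anc Z) Z) n)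
    (h0 : T.node 0 ∉ Z) (hn : T.node n ∉ Z) : ¬ (trailWalk T).IsSigmaBlocked Z := by
  rintro (⟨k, ⟨⟨hk, hkn⟩, h1, h2⟩, h3⟩ | ⟨k, ⟨⟨hkn, hc⟩, h1⟩, h2⟩)
  · exact h3 ((trail_junction T hk hkn).1 h1 h2)
  · have hkn' : k ≤ n := hkn
    rcases Nat.eq_zero_or_pos k with rfl | hk0
    · exact h0 h2
    rcases hkn'.lt_or_eq with hlt | rfl
    · exact h1 ((trailWalk_isUnblockable T ⟨hk0, hlt⟩ ⟨hkn, hc⟩).2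
        ((trail_junction T hk0 hlt).2 h2))
    · exact hn h2

theorem Walk.chain_of_isSigmaInducing {S : Set W} {π : G.Walk} (hπ : π.IsSigmaInducing S)
    (h : π.first ≠ π.last) : ∃ p q n k, Chain G.LEdge
      (Passes (G.anc ({π.first, π.last} ∪ S)) Set.univ) (fun _ => 0) π.first p π.last q n k := by
  have hlen : 0 < π.length := by
    by_contra hc
    apply h
    unfold first last
    rw [show π.length = 0 by omega]
  refine ⟨_, _, _, _, (π.trail (Passes (G.anc ({π.first, π.last} ∪ S)) Set.univ) ?_).chain
    (fun _ => 0) hlen le_rfl⟩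
  intro i hi
  have hin : π.IsInner (i + 1) := ⟨by omega, hi⟩
  by_cases hc : π.IsCollider (i + 1)
  · have hc2 := hc.2
    rw [show i + 1 - 1 = i by omega] at hc2
    refine ⟨fun _ _ => hπ.1 _ hc, fun _ => ⟨fun h1 => ?_, fun h1 => ?_⟩⟩
    · rw [hc2.1] at h1; cases h1
    · rw [hc2.2] at h1; cases h1
  · have hu := hπ.2 _ hin ⟨hi.le, hc⟩
    exact ⟨fun h1 h2 => absurd ⟨hin, h1, h2⟩ hc, fun _ => hu.2.2⟩

theorem Walk.chain_of_not_isSigmaBlocked {Z : Set W} {π : G.Walk} (hπ : ¬ π.IsSigmaBlocked Z)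
    (h : π.first ≠ π.last) : ∃ p q n k, Chain G.LEdge (Passes (G.anc Z) Z) (fun _ => 0)
      π.first p π.last q n k := by
  have hlen : 0 < π.length := by
    by_contra hc
    apply h
    unfold first last
    rw [show π.length = 0 by omega]
  refine ⟨_, _, _, _, (π.trail (Passes (G.anc Z) Z) ?_).chain (fun _ => 0) hlen le_rfl⟩
  intro i hi
  unfold IsSigmaBlocked at hπ
  push Not at hπ
  have hin : π.IsInner (i + 1) := ⟨by omega, hi⟩
  by_cases hc : π.IsCollider (i + 1)
  · have hc2 := hc.2
    rw [show i + 1 - 1 = i by omega] at hc2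
    refine ⟨fun _ _ => hπ.1 _ hc, fun _ => ⟨fun h1 => ?_, fun h1 => ?_⟩⟩
    · rw [hc2.1] at h1; cases h1
    · rw [hc2.2] at h1; cases h1
  · refine ⟨fun h1 h2 => absurd ⟨hin, h1, h2⟩ hc, fun hz => ?_⟩
    by_contra hn
    exact hπ.2 (i + 1) ⟨⟨hi.le, hc⟩, fun hu => hn hu.2.2⟩ hz

theorem Walk.first_last_notMem {Z : Set W} {π : G.Walk} (hπ : ¬ π.IsSigmaBlocked Z) :
    π.first ∉ Z ∧ π.last ∉ Z := by
  unfold IsSigmaBlocked at hπ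
  push Not at hπ
  have h : ∀ k ≤ π.length, ¬ π.IsInner k → π.node k ∉ Z := fun k hk hin =>
    hπ.2 k ⟨⟨hk, fun hc => hin hc.1⟩, fun hu => hin hu.1⟩
  exact ⟨h 0 (by omega) (fun h => absurd h.1 (by omega)),
    h _ le_rfl (fun h => absurd h.2 (by omega))⟩

/-- A σ-inducing walk between distinct nodes can be shortened to a σ-inducing path. -/
theorem exists_isPath_isSigmaInducing {S : Set W} (hG : ∀ a b, ¬ G.edge a .tail .tail b) {a b : W}
    (hab : a ≠ b) (h : ∃ p q n k, Chain G.LEdge (Passes (G.anc ({a, b} ∪ S)) Set.univ) (fun _ => 0)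
      a p b q n k) :
    ∃ π : G.Walk, π.first = a ∧ π.last = b ∧ π.IsPath ∧ π.IsSigmaInducing S := by
  classical
  have h1 : ∃ n, ∃ p q k, Chain G.LEdge (Passes (G.anc ({a, b} ∪ S)) Set.univ) (fun _ => 0)
      a p b q n k := by
    obtain ⟨p, q, n, k, h⟩ := h
    exact ⟨n, p, q, k, h⟩
  obtain ⟨n, hn⟩ : ∃ n, n = Nat.find h1 := ⟨_, rfl⟩
  have min : ∀ {m p q k}, Chain G.LEdge (Passes (G.anc ({a, b} ∪ S)) Set.univ) (fun _ => 0)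
      a p b q m k → n ≤ m := fun {m p q k} hc => hn ▸ Nat.find_min' h1 ⟨p, q, k, hc⟩
  obtain ⟨p, q, k, hc⟩ := Nat.find_spec h1
  rw [← hn] at hc
  obtain ⟨T, h0, -, hnb, -⟩ := hc.exists_trail
  refine ⟨trailWalk T, h0, hnb, ?_, trailWalk_isSigmaInducing T h0 hnb⟩
  have inj' : ∀ i j, i < j → j ≤ n → T.node i ≠ T.node j := by
    intro i j hij hj heq
    have hne : 0 < i ∨ j < n := by
      by_contra hcon
      obtain rfl : i = 0 := by omega
      obtain rfl : j = n := by omega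
      exact hab (h0.symm.trans (heq.trans hnb))
    -- The cut may create a new collider. This is harmless because all nodes of the chain lie in the
    -- ancestral set, and the two remaining labels were already unblockable.
    obtain ⟨p', q', k', hc'⟩ := T.excise (fun _ => 0) hij hj hne heq (fun hi hjn => by
      refine ⟨fun _ _ => trail_mem T hG (fun x y => mem_anc_of_dir) (fun x q r h => h.1)
        (by rw [h0]; exact subset_anc _ (by simp)) (by rw [hnb]; exact subset_anc _ (by simp)) i (by omega), fun _ =>
        ⟨((trail_junction T hi (by omega)).2 trivial).1,
          ((trail_junction T (by omega : 0 < j) hjn).2 trivial).2⟩⟩)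
    rw [h0, hnb] at hc'
    have := min hc'
    omega
  intro i hi j hj hij
  by_contra hne
  rcases Nat.lt_or_gt_of_ne hne with hlt | hlt
  · exact inj' i j hlt hj hij
  · exact inj' j i hlt hi hij.symm

theorem chain_of_reaches {T U Z : Set W} (hZ : Z ⊆ G.anc U) {x a : W}
    (h : Relation.ReflTransGen G.Dir x a) (hx : x ∉ G.anc U) : x = a ∨
    ∃ p q n k, p.1 = .tail ∧ Chain G.LEdge (Passes T Z) (fun _ => 0) x p a q n k := by
  induction h using Relation.ReflTransGen.head_induction_on with
  | refl => exact .inl rfl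
  | @head x y hxy hya ih =>
    have hy : y ∉ G.anc U := fun h => hx (mem_anc_of_dir hxy h)
    have he : G.LEdge x (.tail, EdgeMark.tail = .tail → y ∈ G.sc x)
      (.arrow, EdgeMark.arrow = .tail → x ∈ G.sc y) y := ⟨hxy, Iff.rfl, Iff.rfl⟩
    rcases ih hy with rfl | ⟨p, q, n, k, hp, hc⟩
    · exact .inr ⟨_, _, _, _, rfl, .single he⟩
    · refine .inr ⟨_, _, _, _, rfl, .cons he ⟨fun _ h => ?_, fun hz => absurd (hZ hz) hy⟩ hc⟩
      rw [hp] at h; cases h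

/-- Cut at the last collider outside `G.anc T`: later colliders are in `G.anc T`, and `y`, now an
endpoint, is unconstrained. -/
theorem chain_suffix {T Z : Set W} {a x b : W} {p q : EdgeMark × Prop} {n k : ℕ}
    (h : Chain G.LEdge (Passes (G.anc ({a} ∪ T)) Z) (fun _ => 0) x p b q n k) :
    (∃ n k, Chain G.LEdge (Passes (G.anc T) Z) (fun _ => 0) x p b q n k) ∨
    ∃ y r n k, y ∈ G.anc {a} ∧ y ∉ G.anc T ∧
      Chain G.LEdge (Passes (G.anc T) Z) (fun _ => 0) y r b q n k := by
  induction h with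
  | single e => exact .inl ⟨_, _, .single e⟩
  | @cons x p q y r c s n k e j h ih =>
    rcases ih with ⟨n', k', hc⟩ | hc
    · by_cases hy : q.1 = .arrow ∧ r.1 = .arrow ∧ y ∉ G.anc T
      · exact .inr ⟨y, r, n', k', (mem_anc_union (j.1 hy.1 hy.2.1)).resolve_right hy.2.2, hy.2.2, hc⟩
      · refine .inl ⟨_, _, .cons e ⟨fun h1 h2 => ?_, j.2⟩ hc⟩
        by_contra h3
        exact hy ⟨h1, h2, h3⟩
    · exact .inr hc

/-- The part before the cut node `y` is replaced by a directed walk from `y` to `a`, reversed. It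
stays outside `G.anc T`, hence outside `Z`, and makes `y` a non-collider. -/
theorem exists_chain_of_anc_insert {T Z : Set W} (hZ : Z ⊆ G.anc T) {a b : W}
    (h : ∃ p q n k, Chain G.LEdge (Passes (G.anc ({a} ∪ T)) Z) (fun _ => 0) a p b q n k) :
    ∃ p q n k, Chain G.LEdge (Passes (G.anc T) Z) (fun _ => 0) a p b q n k := by
  obtain ⟨p, q, n, k, h⟩ := h
  rcases chain_suffix h with ⟨n, k, hc⟩ | ⟨y, r, n, k, ⟨a', ha', hya⟩, hy, hc⟩
  · exact ⟨_, _, _, _, hc⟩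
  · obtain rfl : a' = a := ha'
    rcases chain_of_reaches (T := G.anc T) hZ hya hy with rfl | ⟨p', q', n', k', hp, hc'⟩
    · exact ⟨_, _, _, _, hc⟩
    · obtain ⟨k'', hc''⟩ := chain_reverse hc'
      refine ⟨_, _, _, _, hc''.append ⟨fun h => ?_, fun hz => absurd (hZ hz) hy⟩ hc⟩
      rw [hp] at h; cases h

theorem exists_chain_of_anc_endpoints {Z : Set W} {a b : W}
    (h : ∃ p q n k, Chain G.LEdge (Passes (G.anc ({a, b} ∪ Z)) Z) (fun _ => 0) a p b q n k) :
    ∃ p q n k, Chain G.LEdge (Passes (G.anc Z) Z) (fun _ => 0) a p b q n k := by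
  have rev : ∀ {T : Set W} {a b : W},
      (∃ p q n k, Chain G.LEdge (Passes T Z) (fun _ => 0) a p b q n k) →
      ∃ p q n k, Chain G.LEdge (Passes T Z) (fun _ => 0) b p a q n k := by
    rintro T a b ⟨p, q, n, k, hc⟩
    obtain ⟨k', hc'⟩ := chain_reverse hc
    exact ⟨_, _, _, _, hc'⟩
  rw [Set.insert_eq, Set.union_assoc] at h
  have h1 := exists_chain_of_anc_insert (Set.subset_union_right.trans (subset_anc _)) h
  exact rev (exists_chain_of_anc_insert (subset_anc Z) (rev h1))

end MixedGraph

/-! ### Open walks in a representing graph and connecting walks in the DMG. -/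

namespace MixedGraph

variable {V S : Type*} {G : DMG (V ⊕ S)} {H : MixedGraph V}

/-- `x` is an ancestor of `y` or of a selection node. -/
def AntLE (G : DMG (V ⊕ S)) (x y : V) : Prop :=
  Sum.inl x ∈ G.anc ({Sum.inl y} ∪ Set.range Sum.inr)

/-- The nodes given which separation is considered: those of `Z` and the selection nodes. -/
def condSet (S : Type*) (Z : Set V) : Set (V ⊕ S) := Sum.inl '' Z ∪ Set.range Sum.inr

/-- The ancestors of `a`, `b`, `Z` and the selection nodes. -/
def antSet (G : DMG (V ⊕ S)) (a b : V) (Z : Set V) : Set V :=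
  {x | Sum.inl x ∈ G.anc ({Sum.inl a, Sum.inl b} ∪ condSet S Z)}

theorem range_inr_subset_condSet (Z : Set V) : Set.range Sum.inr ⊆ condSet S Z :=
  Set.subset_union_right

theorem inl_mem_condSet {Z : Set V} {x : V} : Sum.inl x ∈ condSet S Z ↔ x ∈ Z := by
  simp [condSet]

theorem antLE_of_mem {x y : V} {B : Set (V ⊕ S)} (hB : Set.range Sum.inr ⊆ G.anc B)
    (h : AntLE G x y) (hy : Sum.inl y ∈ G.anc B) : Sum.inl x ∈ G.anc B := by
  refine anc_subset ?_ h
  rintro z (rfl | hz)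
  · exact hy
  · exact hB hz

theorem antLE_trans {x y z : V} (h : AntLE G x y) (h' : AntLE G y z) : AntLE G x z :=
  antLE_of_mem (Set.subset_union_right.trans (subset_anc _)) h h'

theorem mem_antSet_of_antLE {a b x y : V} {Z : Set V} (h : AntLE G x y) (hy : y ∈ antSet G a b Z) :
    x ∈ antSet G a b Z :=
  antLE_of_mem (((range_inr_subset_condSet Z).trans Set.subset_union_right).trans (subset_anc _))
    h hy

theorem endpoints_union_subset_antSet (a b : V) (Z : Set V) : {a, b} ∪ Z ⊆ antSet G a b Z := by
  rintro x ((rfl | rfl) | hx)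
  · exact subset_anc _ (by simp)
  · exact subset_anc _ (by simp)
  · exact subset_anc _ (.inr (inl_mem_condSet.2 hx))

namespace Represents

open Classical in
/-- The mark at `a` of an edge between `a` and `b` in a graph that represents `G`. -/
noncomputable def markOf (G : DMG (V ⊕ S)) (a b : V) : EdgeMark :=
  if AntLE G a b then .tail else .arrow

theorem markOf_eq_tail {a b : V} : markOf G a b = .tail ↔ AntLE G a b := by
  unfold markOf; split_ifs with h <;> simp [h]

theorem markOf_eq_arrow {a b : V} : markOf G a b = .arrow ↔ ¬ AntLE G a b := by
  unfold markOf; split_ifs with h <;> simp [h]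

theorem mark_eq (h : H.Represents G) {a b : V} {m n : EdgeMark} (he : H.edge a m n b) :
    m = markOf G a b := by
  cases m with
  | tail => exact (markOf_eq_tail.2 (h.tail a b ⟨n, he⟩)).symm
  | arrow => exact (markOf_eq_arrow.2 (h.arrow a b ⟨n, H.symm _ _ _ _ he⟩)).symm

theorem edge_iff (h : H.Represents G) {a b : V} {m n : EdgeMark} :
    H.edge a m n b ↔ H.Adj a b ∧ m = markOf G a b ∧ n = markOf G b a := by
  constructor
  · exact fun he => ⟨⟨m, n, he⟩, h.mark_eq he, h.mark_eq (H.symm _ _ _ _ he)⟩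
  · rintro ⟨⟨m', n', he⟩, rfl, rfl⟩
    rwa [← h.mark_eq he, ← h.mark_eq (H.symm _ _ _ _ he)]

theorem into_iff (h : H.Represents G) {a b : V} : H.Into a b ↔ H.Adj a b ∧ ¬ AntLE G b a := by
  constructor
  · rintro ⟨m, he⟩
    exact ⟨⟨_, _, he⟩, h.arrow _ _ ⟨m, he⟩⟩
  · rintro ⟨ha, hl⟩
    exact ⟨_, h.edge_iff.2 ⟨ha, rfl, (markOf_eq_arrow.2 hl).symm⟩⟩

theorem undir_iff (h : H.Represents G) {a b : V} :
    H.Undir a b ↔ H.Adj a b ∧ AntLE G a b ∧ AntLE G b a := by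
  unfold Undir
  rw [h.edge_iff, eq_comm, markOf_eq_tail, eq_comm, markOf_eq_tail]

theorem dir_iff (h : H.Represents G) {a b : V} :
    H.Dir a b ↔ H.Adj a b ∧ AntLE G a b ∧ ¬ AntLE G b a := by
  unfold Dir
  rw [h.edge_iff, eq_comm, markOf_eq_tail, eq_comm, markOf_eq_arrow]

theorem adj_symm {a b : V} (h : H.Adj a b) : H.Adj b a := by
  obtain ⟨m, n, he⟩ := h
  exact ⟨n, m, H.symm _ _ _ _ he⟩

/-- The walk through given nodes of a graph that represents `G`. -/
noncomputable def walkOf (h : H.Represents G) (n : ℕ) (x : ℕ → V)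
    (hx : ∀ i < n, H.Adj (x i) (x (i + 1))) : H.Walk where
  length := n
  node := x
  startMark i := markOf G (x i) (x (i + 1))
  endMark i := markOf G (x (i + 1)) (x i)
  isEdge i hi := h.edge_iff.2 ⟨hx i hi, rfl, rfl⟩

theorem isCollider_iff (h : H.Represents G) (π : H.Walk) {k : ℕ} : π.IsCollider k ↔
    (0 < k ∧ k < π.length) ∧ ¬ AntLE G (π.node k) (π.node (k - 1)) ∧
      ¬ AntLE G (π.node k) (π.node (k + 1)) := by
  refine and_congr_right fun hk => ?_
  have hk' : 0 < k ∧ k < π.length := hk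
  have h1 := π.isEdge (k - 1) (by omega)
  have h2 := π.isEdge k hk'.2
  rw [show k - 1 + 1 = k by omega] at h1
  rw [h.mark_eq (H.symm _ _ _ _ h1), h.mark_eq h2, markOf_eq_arrow, markOf_eq_arrow]

/-- The adjacencies and anterior order of a σ-MAG that represents `G`. -/
noncomputable def anteriorGraph (h : H.Represents G) (hH : H.IsSigmaMAG) : AnteriorGraph V where
  adj := H.Adj
  le := AntLE G
  symm := adj_symm
  irrefl {a} := hH.loopless a
  trans := antLE_trans
  complete_adj h1 h2 h3 h4 h5 :=
    hH.complete_adj _ _ _ (h.into_iff.2 ⟨h1, h2⟩) (h.undir_iff.2 ⟨h3, h4, h5⟩)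
  complete_nbh h1 h2 h3 h4 h5 h6 h7 h8 h9 :=
    hH.complete_nbh _ _ _ _ (h.into_iff.2 ⟨h1, h2⟩) (h.undir_iff.2 ⟨h3, h4, h5⟩)
      (h.undir_iff.2 ⟨h6, h7, h8⟩) h9
  maximal n x hinj hadj hne hna hc := by
    refine hH.maximal _ _ hne hna ⟨h.walkOf n x hadj, rfl, rfl, hinj, ?_⟩
    rintro k ⟨hk, hkn⟩
    obtain ⟨h1, h2⟩ := hc k hk hkn
    refine ⟨(h.isCollider_iff _).2 ⟨⟨hk, hkn⟩, h1⟩, ?_⟩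
    rcases h2 with h2 | h2
    · exact ⟨x 0, .inl rfl, .single (h.dir_iff.2 h2)⟩
    · exact ⟨x n, .inr rfl, .single (h.dir_iff.2 h2)⟩

/-- Every edge comes from a σ-inducing walk, and the end labels of this walk at arrowheads are not
blockable. -/
theorem exists_chain_of_adj (h : H.Represents G) {u v : V} (ha : H.Adj u v) :
    ∃ p q n k, Chain G.LEdge
      (Passes (G.anc ({Sum.inl u, Sum.inl v} ∪ Set.range Sum.inr)) Set.univ) (fun _ => 0)
      (Sum.inl u) p (Sum.inl v) q n k ∧ (¬ AntLE G u v → p.2) ∧ (¬ AntLE G v u → q.2) := by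
  have key : ∀ {u v : V} {p q : EdgeMark × Prop} {n k : ℕ}, Chain G.LEdge
      (Passes (G.anc ({Sum.inl u, Sum.inl v} ∪ Set.range Sum.inr)) Set.univ) (fun _ => 0)
      (Sum.inl u) p (Sum.inl v) q n k → ¬ AntLE G v u → q.2 := by
    intro u v p q n k hc hl
    have hn := hc.pos
    obtain ⟨T, h0, -, hnv, hq, -⟩ := hc.exists_trail
    by_contra hq2
    have hmem := trail_mem T G.no_undir (fun x y => mem_anc_of_dir) (fun x q r h => h.1)
      (by rw [h0]; exact subset_anc _ (by simp)) (by rw [hnv]; exact subset_anc _ (by simp))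
      (n - 1) (by omega)
    obtain ⟨h1, -, h2⟩ := T.edge (n - 1) (by omega)
    rw [show n - 1 + 1 = n by omega, hq, hnv] at h1 h2
    rw [h2] at hq2
    push Not at hq2
    obtain ⟨hq1, hsc⟩ := hq2
    rw [hq1] at h1
    have hp : (T.start (n - 1)).1 = .arrow :=
      EdgeMark.eq_arrow_of_ne fun h => G.no_undir _ _ (h ▸ h1)
    rw [hp] at h1
    have hd : G.Dir (Sum.inl v) (T.node (n - 1)) := G.symm _ _ _ _ h1
    -- The last edge, read backwards, leaves `v` for another component. Its other end is an ancestor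
    -- of `u`, `v` or a selection node: via `v` it would be in the same component, otherwise `AntLE
    -- G v u` would hold.
    obtain ⟨z, (rfl | rfl) | hz, hr⟩ := hmem
    · exact hl (mem_anc_of_dir hd ⟨_, .inl rfl, hr⟩)
    · exact hsc ⟨hr, .single hd⟩
    · exact hl (mem_anc_of_dir hd ⟨_, .inr hz, hr⟩)
  have hne : u ≠ v := by rintro rfl; exact h.loopless _ ha
  obtain ⟨π, h1, h2, -, hπ⟩ := (h.adj_iff u v hne).1 ha
  have hch := Walk.chain_of_isSigmaInducing hπ (by rw [h1, h2]; simpa using hne)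
  rw [h1, h2] at hch
  obtain ⟨p, q, n, k, hc⟩ := hch
  refine ⟨p, q, n, k, hc, fun hl => ?_, key hc⟩
  obtain ⟨k', hc'⟩ := chain_reverse hc
  rw [Set.pair_comm] at hc'
  exact key hc' hl

theorem adj_of_chain (h : H.Represents G) {u v : V} (huv : u ≠ v)
    (hc : ∃ p q n k, Chain G.LEdge
      (Passes (G.anc ({Sum.inl u, Sum.inl v} ∪ Set.range Sum.inr)) Set.univ) (fun _ => 0)
      (Sum.inl u) p (Sum.inl v) q n k) : H.Adj u v :=
  (h.adj_iff u v huv).2 (exists_isPath_isSigmaInducing G.no_undir (by simpa using huv) hc)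

end Represents

/-- `w` is a walk of length `n` from `a` to `b` in `A` whose non-colliders are not in `Z`. -/
structure _root_.AnteriorGraph.OpenWalk (M : AnteriorGraph V) (A Z : Set V) (a b : V) (n : ℕ)
    (w : ℕ → V) : Prop where
  first : w 0 = a
  last : w n = b
  adj : ∀ i < n, M.adj (w i) (w (i + 1))
  mem : ∀ i ≤ n, w i ∈ A
  coll : ∀ i, 0 < i → i < n → w i ∈ Z → M.Coll (w (i - 1)) (w i) (w (i + 1))

/-- There is a walk in `G` between `a` and `b` whose intermediate nodes do not block it given `Z`
and the selection nodes. -/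
def Connects (G : DMG (V ⊕ S)) (a b : V) (Z : Set V) : Prop :=
  ∃ p q n k, Chain G.LEdge (Passes (G.anc (condSet S Z)) (condSet S Z)) (fun _ => 0)
    (Sum.inl a) p (Sum.inl b) q n k

namespace Represents

/-- Concatenate the σ-inducing walks behind the edges. At a collider of `H` the adjoining labels are
unblockable, so a junction in `Z` does not block, and all junctions are ancestral. Finally `a` and
`b` are removed from the set whose ancestors may be colliders. -/
theorem connects_of_openWalk (h : H.Represents G) (hH : H.IsSigmaMAG) {a b : V} (hab : a ≠ b)
    {Z : Set V} {n : ℕ} {w : ℕ → V}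
    (hw : (h.anteriorGraph hH).OpenWalk (antSet G a b Z) Z a b n w) : Connects G a b Z := by
  refine exists_chain_of_anc_endpoints ?_
  have hn : 0 < n := by
    by_contra hn
    obtain rfl : n = 0 := by omega
    exact hab (hw.first.symm.trans hw.last)
  have key : ∀ m < n, ∃ p q l k, Chain G.LEdge
      (Passes (G.anc ({Sum.inl a, Sum.inl b} ∪ condSet S Z)) (condSet S Z)) (fun _ => 0)
      (Sum.inl (w 0)) p (Sum.inl (w (m + 1))) q l k ∧ (¬ AntLE G (w (m + 1)) (w m) → q.2) := by
    intro m hm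
    obtain ⟨p, q, l, k, hc, hp, hq⟩ := h.exists_chain_of_adj (hw.adj m hm)
    have hc' := hc.mono (fun _ _ _ _ h => h) (fun _ _ _ h => Passes.mono
      (T' := G.anc ({Sum.inl a, Sum.inl b} ∪ condSet S Z)) (Z' := condSet S Z)
      (anc_subset (by
        rintro z ((rfl | rfl) | hz)
        · exact hw.mem m hm.le
        · exact hw.mem (m + 1) hm
        · exact subset_anc _ (.inr (range_inr_subset_condSet Z hz)))) (Set.subset_univ _) h)
    clear hc
    induction m generalizing p q l k with
    | zero => exact ⟨p, q, l, k, hc', hq⟩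
    | succ m ih =>
      obtain ⟨p₁, q₁, l₁, k₁, hc₁, hp₁, hq₁⟩ := h.exists_chain_of_adj (hw.adj m (by omega))
      obtain ⟨p₂, q₂, l₂, k₂, hc₂, hq₂⟩ := ih (by omega) p₁ q₁ l₁ k₁ hp₁ hq₁
        (hc₁.mono (fun _ _ _ _ h => h) (fun _ _ _ h => Passes.mono
          (anc_subset (by
            rintro z ((rfl | rfl) | hz)
            · exact hw.mem m (by omega)
            · exact hw.mem (m + 1) (by omega)
            · exact subset_anc _ (.inr (range_inr_subset_condSet Z hz)))) (Set.subset_univ _) h))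
      refine ⟨_, _, _, _, hc₂.append ⟨fun _ _ => hw.mem (m + 1) (by omega), fun hz => ?_⟩ hc', hq⟩
      have := hw.coll (m + 1) (by omega) hm (inl_mem_condSet.1 hz)
      exact ⟨hq₂ this.1, hp this.2⟩
  obtain ⟨p, q, l, k, hc, -⟩ := key (n - 1) (by omega)
  rw [show n - 1 + 1 = n by omega, hw.first, hw.last] at hc
  exact ⟨p, q, l, k, hc⟩

/-- `x` and `y` are connected by a σ-inducing walk with the given labels at its ends. -/
def IndEdge (G : DMG (V ⊕ S)) (x : V ⊕ S) (p q : EdgeMark × Prop) (y : V ⊕ S) : Prop :=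
  ∃ n k, Chain G.LEdge (Passes (G.anc ({x, y} ∪ Set.range Sum.inr)) Set.univ) (fun _ => 0) x p y q n k

/-- Regard the connecting walk as a chain of σ-inducing walks and take a shortest such chain. Its
nodes form the walk in `H`. -/
theorem openWalk_of_connects (h : H.Represents G) (hH : H.IsSigmaMAG) {a b : V} (hab : a ≠ b)
    {Z : Set V} (hc : Connects G a b Z) :
    ∃ n w, (h.anteriorGraph hH).OpenWalk (antSet G a b Z) Z a b n w := by
  classical
  let J : V ⊕ S → EdgeMark × Prop → EdgeMark × Prop → Prop := fun x q r =>
    x ∈ G.anc ({Sum.inl a, Sum.inl b} ∪ condSet S Z) ∧ (x ∈ condSet S Z → q.2 ∧ r.2)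
  have h1 : ∃ n p q k, Chain (IndEdge G) J (fun _ => 0) (Sum.inl a) p (Sum.inl b) q n k := by
    obtain ⟨p, q, n, k, hc⟩ := hc
    obtain ⟨T, h0, -, hn, -⟩ := hc.exists_trail
    have hmem := trail_mem T G.no_undir (A := G.anc ({Sum.inl a, Sum.inl b} ∪ condSet S Z))
      (fun x y => mem_anc_of_dir) (fun x q r h h1 h2 => anc_mono Set.subset_union_right (h.1 h1 h2))
      (by rw [h0]; exact subset_anc _ (by simp)) (by rw [hn]; exact subset_anc _ (by simp))
    let T' : Trail (IndEdge G) J n :=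
      { node := T.node
        start := T.start
        fin := T.fin
        edge := fun i hi => ⟨_, _, .single (T.edge i hi)⟩
        junction := fun i hi => ⟨hmem (i + 1) hi.le, (T.junction i hi).2⟩ }
    have := T'.chain (fun _ => 0) hc.pos le_rfl
    rw [show T'.node 0 = _ from h0, show T'.node n = _ from hn] at this
    exact ⟨_, _, _, _, this⟩
  obtain ⟨n, hn⟩ : ∃ n, n = Nat.find h1 := ⟨_, rfl⟩
  have min : ∀ {m p q k}, Chain (IndEdge G) J (fun _ => 0) (Sum.inl a) p (Sum.inl b) q m k → n ≤ m :=
    fun {m p q k} hc => hn ▸ Nat.find_min' h1 ⟨p, q, k, hc⟩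
  obtain ⟨p, q, k, hc⟩ := Nat.find_spec h1
  rw [← hn] at hc
  obtain ⟨T, h0, -, hnb, -⟩ := hc.exists_trail
  -- Otherwise the two σ-inducing walks at this node would join to one, contradicting minimality.
  -- Hence no selection node is left, and the inner nodes in `Z` are colliders in `H`.
  have inner : ∀ i, 0 < i → i < n → T.node i ∈ condSet S Z →
      T.node i ∉ G.anc ({T.node (i - 1), T.node (i + 1)} ∪ Set.range Sum.inr) := by
    intro i hi hin hz hmem
    have hj := T.junction (i - 1) (by omega)
    obtain ⟨n₁, k₁, hc₁⟩ := T.edge (i - 1) (by omega)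
    obtain ⟨n₂, k₂, hc₂⟩ := T.edge i hin
    rw [show i - 1 + 1 = i by omega] at hj hc₁
    have hS : Set.range Sum.inr ⊆ G.anc ({T.node (i - 1), T.node (i + 1)} ∪ Set.range Sum.inr) :=
      Set.subset_union_right.trans (subset_anc _)
    have hc₁' := hc₁.mono (fun _ _ _ _ h => h) (fun _ _ _ h => Passes.mono
      (T' := G.anc ({T.node (i - 1), T.node (i + 1)} ∪ Set.range Sum.inr)) (anc_subset (by
        rintro z ((rfl | rfl) | hz)
        · exact subset_anc _ (by simp)
        · exact hmem
        · exact hS hz)) subset_rfl h)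
    have hc₂' := hc₂.mono (fun _ _ _ _ h => h) (fun _ _ _ h => Passes.mono
      (T' := G.anc ({T.node (i - 1), T.node (i + 1)} ∪ Set.range Sum.inr)) (anc_subset (by
        rintro z ((rfl | rfl) | hz)
        · exact hmem
        · exact subset_anc _ (by simp)
        · exact hS hz)) subset_rfl h)
    obtain ⟨p', q', hc'⟩ := T.splice (fun _ => 0) (i := i - 1) (j := i + 1) (by omega) (by omega)
      (.single ⟨_, _, hc₁'.append ⟨fun _ _ => hmem, fun _ => hj.2 hz⟩ hc₂'⟩)
      (fun hi' => by
        have := T.junction (i - 1 - 1) (by omega)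
        rwa [show i - 1 - 1 + 1 = i - 1 by omega] at this)
      (fun hi' => T.junction i hi')
    rw [h0, hnb] at hc'
    have := min hc'
    omega
  have hne : ∀ i < n, T.node i ≠ T.node (i + 1) := by
    intro i hi heq
    have hne' : 0 < i ∨ i + 1 < n := by
      by_contra hcon
      obtain rfl : i = 0 := by omega
      obtain rfl : n = 1 := by omega
      exact hab (Sum.inl_injective (h0.symm.trans (heq.trans hnb)))
    obtain ⟨p', q', k', hc'⟩ := T.excise (fun _ => 0) (i := i) (j := i + 1) (by omega) hi hne' heq
      (fun hi' hin => by
        have h2 := T.junction (i - 1) (by omega)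
        have h3 := T.junction i hin
        rw [show i - 1 + 1 = i by omega] at h2
        rw [← heq] at h3
        exact ⟨h2.1, fun hz => ⟨(h2.2 hz).1, (h3.2 hz).2⟩⟩)
    rw [h0, hnb] at hc'
    have := min hc'
    omega
  let w : ℕ → V := fun i => Sum.elim id (fun _ => a) (T.node i)
  have hw : ∀ i ≤ n, T.node i = Sum.inl (w i) := by
    intro i hi
    rcases hx : T.node i with v | s
    · simp [w, hx]
    · exfalso
      rcases Nat.eq_zero_or_pos i with rfl | hi0
      · rw [h0] at hx; cases hx
      rcases hi.lt_or_eq with hi1 | hi1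
      · refine inner i hi0 hi1 ?_ (subset_anc _ ?_)
        · rw [hx]; exact range_inr_subset_condSet Z ⟨s, rfl⟩
        · rw [hx]; exact .inr ⟨s, rfl⟩
      · rw [hi1, hnb] at hx; cases hx
  refine ⟨n, w, ⟨?_, ?_, ?_, ?_, ?_⟩⟩
  · exact Sum.inl_injective ((hw 0 (by omega)).symm.trans h0)
  · exact Sum.inl_injective ((hw n le_rfl).symm.trans hnb)
  · intro i hi
    have hne := hne i hi
    obtain ⟨n', k', hc'⟩ := T.edge i hi
    rw [hw i hi.le, hw (i + 1) hi] at hne hc'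
    exact h.adj_of_chain (fun e => hne (by rw [e])) ⟨_, _, _, _, hc'⟩
  · intro i hi
    change Sum.inl (w i) ∈ G.anc ({Sum.inl a, Sum.inl b} ∪ condSet S Z)
    rw [← hw i hi]
    rcases Nat.eq_zero_or_pos i with rfl | hi0
    · rw [h0]; exact subset_anc _ (by simp)
    rcases hi.lt_or_eq with hi1 | hi1
    · have := T.junction (i - 1) (by omega)
      rw [show i - 1 + 1 = i by omega] at this
      exact this.1
    · rw [hi1, hnb]; exact subset_anc _ (by simp)
  · intro i hi hin hz
    have key := inner i hi hin (by rw [hw i hin.le]; exact inl_mem_condSet.2 hz)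
    rw [hw i hin.le, hw (i - 1) (by omega), hw (i + 1) hin] at key
    exact ⟨fun hl => key (anc_mono (by
        rintro z (rfl | hz)
        · simp
        · exact .inr hz) hl),
      fun hl => key (anc_mono (by
        rintro z (rfl | hz)
        · simp
        · exact .inr hz) hl)⟩

/-- Distinct non-adjacent nodes can be separated. -/
theorem exists_not_connects (h : H.Represents G) {a b : V} (hab : a ≠ b) (hadj : ¬ H.Adj a b) :
    ∃ Z : Set V, a ∉ Z ∧ b ∉ Z ∧ ¬ Connects G a b Z := by
  classical
  let D := G.anc ({Sum.inl a, Sum.inl b} ∪ Set.range Sum.inr)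
  -- With this choice a shortest connecting walk lies in `D` and has all its inner nodes conditioned
  -- on; it is therefore σ-inducing.
  let Z : Set V := {x | x ≠ a ∧ x ≠ b ∧ Sum.inl x ∈ D}
  refine ⟨Z, fun h => h.1 rfl, fun h => h.2.1 rfl, fun hc => hadj ?_⟩
  have h1 : ∃ n p q k, Chain G.LEdge (Passes (G.anc (condSet S Z)) (condSet S Z)) (fun _ => 0)
      (Sum.inl a) p (Sum.inl b) q n k := by
    obtain ⟨p, q, n, k, hc⟩ := hc
    exact ⟨n, p, q, k, hc⟩
  obtain ⟨n, hn⟩ : ∃ n, n = Nat.find h1 := ⟨_, rfl⟩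
  have min : ∀ {m p q k}, Chain G.LEdge (Passes (G.anc (condSet S Z)) (condSet S Z)) (fun _ => 0)
      (Sum.inl a) p (Sum.inl b) q m k → n ≤ m :=
    fun {m p q k} hc => hn ▸ Nat.find_min' h1 ⟨p, q, k, hc⟩
  obtain ⟨p, q, k, hc⟩ := Nat.find_spec h1
  rw [← hn] at hc
  obtain ⟨T, h0, -, hnb, -⟩ := hc.exists_trail
  have hD : G.anc (condSet S Z) ⊆ D := by
    refine anc_subset ?_
    rintro z (⟨x, hx, rfl⟩ | hz)
    · exact hx.2.2
    · exact subset_anc _ (.inr hz)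
  have hmem := trail_mem T G.no_undir (A := D) (fun x y => mem_anc_of_dir)
    (fun x q r h h1 h2 => hD (h.1 h1 h2)) (by rw [h0]; exact subset_anc _ (by simp))
    (by rw [hnb]; exact subset_anc _ (by simp))
  have hcut : ∀ i, 0 < i → i < n → T.node i ∈ condSet S Z := by
    intro i hi hin
    rcases hx : T.node i with v | s
    · have hv := hmem i hin.le
      rw [hx] at hv
      refine inl_mem_condSet.2 ⟨?_, ?_, hv⟩
      · rintro rfl
        obtain ⟨p', q', k', hc'⟩ := T.excise (fun _ => 0) hi hin.le (.inr hin) (h0.trans hx.symm)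
          (fun h => absurd h (by omega))
        rw [h0, hnb] at hc'
        have := min hc'
        omega
      · rintro rfl
        obtain ⟨p', q', k', hc'⟩ := T.excise (fun _ => 0) hin le_rfl (.inl hi) (hx.trans hnb.symm)
          (fun _ h => absurd h (by omega))
        rw [h0, hnb] at hc'
        have := min hc'
        omega
    · exact range_inr_subset_condSet Z ⟨s, rfl⟩
  let T' : Trail G.LEdge (Passes D Set.univ) n :=
    { node := T.node
      start := T.start
      fin := T.fin
      edge := T.edge
      junction := fun i hi => ⟨fun h1 h2 => hD ((T.junction i hi).1 h1 h2),
        fun _ => (T.junction i hi).2 (hcut (i + 1) (by omega) hi)⟩ }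
  have key := T'.chain (fun _ => 0) hc.pos le_rfl
  rw [show T'.node 0 = _ from h0, show T'.node n = _ from hnb] at key
  exact h.adj_of_chain hab ⟨_, _, _, _, key⟩

end Represents

end MixedGraph

/-! ### Pairwise form of Markov equivalence and the two implications. -/

namespace MixedGraph

variable {V S : Type*} {G G₁ G₂ : DMG (V ⊕ S)} {H H₁ H₂ : MixedGraph V}

/-- Endpoints are blockable non-colliders, so only pairs outside `Z` count; the trivial walk at such
a node is never blocked, whence `a ≠ b`. -/
theorem sigmaSep_iff {X Y Z : Set V} :
    G.SigmaSep (Sum.inl '' X) (Sum.inl '' Y) (condSet S Z) ↔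
      ∀ a ∈ X, ∀ b ∈ Y, a ∉ Z → b ∉ Z → a ≠ b ∧ ¬ Connects G a b Z := by
  constructor
  · intro h a ha b hb haZ hbZ
    constructor
    · rintro rfl
      let T : Trail G.LEdge (Passes (G.anc (condSet S Z)) (condSet S Z)) 0 :=
        { node := fun _ => Sum.inl a
          start := fun _ => (.tail, True)
          fin := fun _ => (.tail, True)
          edge := fun i hi => absurd hi (by omega)
          junction := fun i hi => absurd hi (by omega) }
      exact trailWalk_not_isSigmaBlocked T (fun h => haZ (inl_mem_condSet.1 h))
        (fun h => haZ (inl_mem_condSet.1 h)) (h (trailWalk T) ⟨a, ha, rfl⟩ ⟨a, hb, rfl⟩)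
    · rintro ⟨p, q, n, k, hc⟩
      obtain ⟨T, h0, -, hn, -⟩ := hc.exists_trail
      refine trailWalk_not_isSigmaBlocked T ?_ ?_
        (h (trailWalk T) ⟨a, ha, h0.symm⟩ ⟨b, hb, hn.symm⟩)
      · rw [h0]; exact fun h => haZ (inl_mem_condSet.1 h)
      · rw [hn]; exact fun h => hbZ (inl_mem_condSet.1 h)
  · rintro h π ⟨a, ha, h0⟩ ⟨b, hb, hn⟩
    by_contra hπ
    obtain ⟨h1, h2⟩ := Walk.first_last_notMem hπ
    rw [← h0] at h1
    rw [← hn] at h2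
    obtain ⟨hab, hc⟩ := h a ha b hb (fun h => h1 (inl_mem_condSet.2 h))
      (fun h => h2 (inl_mem_condSet.2 h))
    have := Walk.chain_of_not_isSigmaBlocked hπ (by rw [← h0, ← hn]; simpa using hab)
    rw [← h0, ← hn] at this
    exact hc this

theorem sigmaMarkovEquiv_iff : G₁.SigmaMarkovEquiv G₂ ↔
    ∀ (a b : V) (Z : Set V), a ≠ b → a ∉ Z → b ∉ Z → (Connects G₁ a b Z ↔ Connects G₂ a b Z) := by
  constructor
  · intro h a b Z hab ha hb
    have key := h {a} {b} Z
    change G₁.SigmaSep _ _ (condSet S Z) ↔ G₂.SigmaSep _ _ (condSet S Z) at key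
    rw [sigmaSep_iff, sigmaSep_iff] at key
    simpa [ha, hb, hab, not_iff_not] using key
  · intro h X Y Z
    change G₁.SigmaSep _ _ (condSet S Z) ↔ G₂.SigmaSep _ _ (condSet S Z)
    rw [sigmaSep_iff, sigmaSep_iff]
    refine forall₂_congr fun a _ => forall₂_congr fun b _ => forall₂_congr fun ha hb => ?_
    refine and_congr_right fun hab => ?_
    rw [h a b Z hab ha hb]

namespace Represents

theorem isUnshieldedCollider_iff (h : H.Represents G) (hH : H.IsSigmaMAG) {a b c : V} :
    H.IsUnshieldedCollider a b c ↔ a ≠ c ∧ ¬ H.Adj a c ∧ H.Adj a b ∧ H.Adj b c ∧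
      (h.anteriorGraph hH).Coll a b c := by
  unfold IsUnshieldedCollider
  rw [h.into_iff, h.into_iff]
  constructor
  · rintro ⟨-, -, h1, h2, ⟨h3, h4⟩, h5, h6⟩
    exact ⟨h1, h2, h3, adj_symm h5, h4, h6⟩
  · rintro ⟨h1, h2, h3, h4, h5, h6⟩
    refine ⟨?_, ?_, h1, h2, ⟨h3, h5⟩, adj_symm h4, h6⟩
    · rintro rfl; exact h.loopless _ h3
    · rintro rfl; exact h.loopless _ h4

theorem hasCollider_iff (h : H.Represents G) (hH : H.IsSigmaMAG) {π : H.Walk} (hπ : π.IsPath)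
    {k : ℕ} (hk : k + 2 ≤ π.length) : π.HasCollider (π.node (k + 1)) ↔
      (h.anteriorGraph hH).Coll (π.node k) (π.node (k + 1)) (π.node (k + 2)) := by
  have e : π.IsCollider (k + 1) ↔
      (h.anteriorGraph hH).Coll (π.node k) (π.node (k + 1)) (π.node (k + 2)) :=
    (h.isCollider_iff π).trans (and_iff_right ⟨by omega, by omega⟩)
  rw [← e]
  constructor
  · rintro ⟨j, hj, hc⟩
    have hjl : j < π.length := hc.1.2
    rwa [← hπ j hjl.le (k + 1) (by omega) hj]
  · exact fun hc => ⟨k + 1, rfl, hc⟩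

theorem isDiscriminating_iff (h : H.Represents G) (hH : H.IsSigmaMAG) {π : H.Walk} {v : V} :
    π.IsDiscriminating v ↔ ∃ n, π.length = n + 3 ∧ π.IsPath ∧ π.node (n + 2) = v ∧
      ¬ H.Adj (π.node 0) (π.node (n + 3)) ∧ ∀ k ≤ n,
        (h.anteriorGraph hH).Coll (π.node k) (π.node (k + 1)) (π.node (k + 2)) ∧
        (h.anteriorGraph hH).Dir (π.node (k + 1)) (π.node (n + 3)) := by
  refine exists_congr fun n => and_congr_right fun hn => and_congr_right fun _ =>
    and_congr_right fun _ => ?_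
  unfold Walk.first Walk.last
  rw [hn]
  refine and_congr_right fun _ => forall₂_congr fun k hk => and_congr ?_ h.dir_iff
  exact (h.isCollider_iff π).trans (and_iff_right ⟨by omega, by omega⟩)

theorem sameColliders (h₁ : H₁.Represents G₁) (h₂ : H₂.Represents G₂) (hH₁ : H₁.IsSigmaMAG)
    (hH₂ : H₂.IsSigmaMAG) (h : H₁.SameBasicColliders H₂) :
    (h₁.anteriorGraph hH₁).SameColliders (h₂.anteriorGraph hH₂) where
  adj := h.adj
  unshielded a b c hac hadj hab hbc := by
    have key := h.unshielded a b c
    rw [h₁.isUnshieldedCollider_iff hH₁, h₂.isUnshieldedCollider_iff hH₂, ← h.adj, ← h.adj,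
      ← h.adj] at key
    have e : H₁.Adj a b ∧ H₁.Adj b c ∧ ¬ H₁.Adj a c := ⟨hab, hbc, hadj⟩
    simpa [e, hac] using key
  discriminating n x hinj hadj hna hc₁ hc₂ := by
    have hadj₂ : ∀ i < n + 3, H₂.Adj (x i) (x (i + 1)) := fun i hi => (h.adj _ _).1 (hadj i hi)
    have key := h.discriminating (h₁.walkOf (n + 3) x hadj) (h₂.walkOf (n + 3) x hadj₂) (x (n + 2))
      rfl (fun _ _ => rfl) ((h₁.isDiscriminating_iff hH₁).2 ⟨n, rfl, hinj, rfl, hna, hc₁⟩)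
      ((h₂.isDiscriminating_iff hH₂).2
        ⟨n, rfl, hinj, rfl, fun ha => hna ((h.adj _ _).2 ha), hc₂⟩)
    have e₁ := h₁.hasCollider_iff hH₁ (π := h₁.walkOf (n + 3) x hadj) hinj (k := n + 1) le_rfl
    have e₂ := h₂.hasCollider_iff hH₂ (π := h₂.walkOf (n + 3) x hadj₂) hinj (k := n + 1) le_rfl
    exact e₁.symm.trans (key.trans e₂)

/-- An anterior of `B` that is not an ancestor of a selection node reaches `B` along an anterior
walk. -/
theorem exists_reaches (h : H.Represents G) (hH : H.IsSigmaMAG) {B : Set V} {z v : V ⊕ S}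
    (hr : Relation.ReflTransGen G.Dir z v) (hv : v ∈ condSet S B) :
    ∀ x, z = Sum.inl x → Sum.inl x ∉ G.anc (Set.range Sum.inr) →
      ∃ r, (h.anteriorGraph hH).Reaches B r x := by
  induction hr using Relation.ReflTransGen.head_induction_on with
  | refl =>
    rintro x rfl -
    exact ⟨0, inl_mem_condSet.1 hv⟩
  | @head z y hzy hyv ih =>
    rintro x rfl hx
    rcases y with y | s
    · obtain ⟨r, hr⟩ := ih y rfl (fun hy => hx (mem_anc_of_dir hzy hy))
      refine ⟨r + 1, y, ?_, mem_anc_of_dir hzy (subset_anc _ (by simp)), hr⟩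
      refine h.adj_of_chain (by rintro rfl; exact G.loopless _ _ _ hzy) ⟨(.tail, EdgeMark.tail = .tail → Sum.inl y ∈ G.sc (Sum.inl x)),
        (.arrow, EdgeMark.arrow = .tail → Sum.inl x ∈ G.sc (Sum.inl y)), _, _, .single ⟨hzy, Iff.rfl, Iff.rfl⟩⟩
    · exact absurd ⟨_, ⟨s, rfl⟩, .single hzy⟩ hx

theorem connects_transfer (h₁ : H₁.Represents G₁) (h₂ : H₂.Represents G₂) (hH₁ : H₁.IsSigmaMAG)
    (hH₂ : H₂.IsSigmaMAG) (h : H₁.SameBasicColliders H₂) {a b : V} {Z : Set V} (hab : a ≠ b)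
    (ha : a ∉ Z) (hb : b ∉ Z) (hc : Connects G₁ a b Z) : Connects G₂ a b Z := by
  obtain ⟨n, w, hw⟩ := h₁.openWalk_of_connects hH₁ hab hc
  have hn : 0 < n := by
    by_contra hn
    obtain rfl : n = 0 := by omega
    exact hab (hw.first.symm.trans hw.last)
  let M := h₁.anteriorGraph hH₁
  let T : Trail M.Edge (M.Open (antSet G₁ a b Z) Z) n :=
    { node := w
      start := fun i => w (i + 1)
      fin := w
      edge := fun i hi => ⟨hw.adj i hi, rfl, rfl⟩
      junction := fun i hi => ⟨hw.mem _ hi.le, hw.coll (i + 1) (by omega) hi⟩ }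
  have hch := T.chain (M.dist ({a, b} ∪ Z)) hn le_rfl
  rw [show T.node 0 = a from hw.first, show T.node n = b from hw.last] at hch
  have hreach : ∀ x u, x ∈ antSet G₁ a b Z → ¬ AntLE G₁ x u → ∃ r, M.Reaches ({a, b} ∪ Z) r x := by
    rintro x u ⟨v, hv, hr⟩ hl
    refine h₁.exists_reaches hH₁ hr ?_ x rfl (fun hx => hl (anc_mono Set.subset_union_right hx))
    rcases hv with (rfl | rfl) | ⟨z, hz, rfl⟩ | hv
    · exact inl_mem_condSet.2 (by simp)
    · exact inl_mem_condSet.2 (by simp)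
    · exact inl_mem_condSet.2 (.inr hz)
    · exact range_inr_subset_condSet _ hv
  obtain ⟨n', w', h0, hn', h3, h4, h5⟩ := (h₁.sameColliders h₂ hH₁ hH₂ h).exists_chain
    (B := {a, b} ∪ Z) (A₂ := antSet G₂ a b Z) hab (by simp) (by simp) ha hb
    (endpoints_union_subset_antSet a b Z) (endpoints_union_subset_antSet a b Z)
    (fun x y _ hl hy => mem_antSet_of_antLE hl hy) (fun x y _ hl hy => mem_antSet_of_antLE hl hy)
    hreach ⟨_, _, _, _, hch⟩
  exact h₂.connects_of_openWalk hH₂ hab ⟨h0, hn', h3, h4, h5⟩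

/-- An edge is an open walk given every `Z`, whereas non-adjacent nodes are separated by some `Z`.
-/
theorem adj_of_adj (h₁ : H₁.Represents G₁) (h₂ : H₂.Represents G₂) (hH₁ : H₁.IsSigmaMAG)
    (h : ∀ (a b : V) (Z : Set V), a ≠ b → a ∉ Z → b ∉ Z → Connects G₁ a b Z → Connects G₂ a b Z)
    {a b : V} (hadj : H₁.Adj a b) : H₂.Adj a b := by
  have hab : a ≠ b := by rintro rfl; exact h₁.loopless _ hadj
  by_contra hna
  obtain ⟨Z, ha, hb, hZ⟩ := h₂.exists_not_connects hab hna
  refine hZ (h a b Z hab ha hb (h₁.connects_of_openWalk hH₁ hab (n := 1)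
    (w := fun i => if i = 0 then a else b) ⟨rfl, rfl, ?_, ?_, ?_⟩))
  · intro i hi
    obtain rfl : i = 0 := by omega
    exact hadj
  · intro i _
    split_ifs
    · exact endpoints_union_subset_antSet a b Z (by simp)
    · exact endpoints_union_subset_antSet a b Z (by simp)
  · intro i h1 h2; omega

/-- If the nodes between the first and the last but one are colliders and parents of the last node
in both graphs, then the last but one node is a collider in both graphs or in neither. -/
theorem coll_of_coll (h₁ : H₁.Represents G₁) (h₂ : H₂.Represents G₂) (hH₁ : H₁.IsSigmaMAG)
    (hH₂ : H₂.IsSigmaMAG)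
    (h : ∀ (a b : V) (Z : Set V), a ≠ b → a ∉ Z → b ∉ Z → (Connects G₁ a b Z ↔ Connects G₂ a b Z))
    {n : ℕ} {x : ℕ → V} (hne : x 0 ≠ x (n + 2)) (hna : ¬ H₁.Adj (x 0) (x (n + 2)))
    (hadj₁ : ∀ i < n + 2, H₁.Adj (x i) (x (i + 1))) (hadj₂ : ∀ i < n + 2, H₂.Adj (x i) (x (i + 1)))
    (hc₁ : ∀ k < n, (h₁.anteriorGraph hH₁).Coll (x k) (x (k + 1)) (x (k + 2)) ∧
      (h₁.anteriorGraph hH₁).Dir (x (k + 1)) (x (n + 2)))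
    (hc₂ : ∀ k < n, (h₂.anteriorGraph hH₂).Coll (x k) (x (k + 1)) (x (k + 2)))
    (hc : (h₁.anteriorGraph hH₁).Coll (x n) (x (n + 1)) (x (n + 2))) :
    (h₂.anteriorGraph hH₂).Coll (x n) (x (n + 1)) (x (n + 2)) := by
  obtain ⟨Z, ha, hb, hZ⟩ := h₁.exists_not_connects hne hna
  have hno₁ : ∀ {m w}, ¬ (h₁.anteriorGraph hH₁).OpenWalk
      (antSet G₁ (x 0) (x (n + 2)) Z) Z (x 0) (x (n + 2)) m w :=
    fun {m w} hw => hZ (h₁.connects_of_openWalk hH₁ hne hw)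
  have hno₂ : ∀ {m w}, ¬ (h₂.anteriorGraph hH₂).OpenWalk
      (antSet G₂ (x 0) (x (n + 2)) Z) Z (x 0) (x (n + 2)) m w :=
    fun {m w} hw => hZ ((h _ _ Z hne ha hb).2 (h₂.connects_of_openWalk hH₂ hne hw))
  have hB₁ := endpoints_union_subset_antSet (G := G₁) (x 0) (x (n + 2)) Z
  have hB₂ := endpoints_union_subset_antSet (G := G₂) (x 0) (x (n + 2)) Z
  -- At the first such node outside `Z`, stepping directly to the last node gives an open walk: the
  -- earlier nodes are colliders in `Z`, and this one is a non-collider outside `Z`.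
  have hmem : ∀ k < n, x (k + 1) ∈ Z := by
    intro k
    induction k using Nat.strong_induction_on with
    | _ k ih =>
      intro hk
      by_contra hz
      refine hno₁ (m := k + 2) (w := fun i => if i ≤ k + 1 then x i else x (n + 2))
        ⟨rfl, by simp, ?_, ?_, ?_⟩
      · intro i hi
        obtain rfl | hlt : i = k + 1 ∨ i < k + 1 := by omega
        · simpa using (hc₁ k hk).2.1
        · rw [if_pos (by omega), if_pos (by omega)]
          exact hadj₁ i (by omega)
      · intro i hi
        split_ifs with h3
        · rcases i with _ | i
          · exact hB₁ (by simp)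
          obtain rfl | hlt : i = k ∨ i < k := by omega
          · exact mem_antSet_of_antLE (hc₁ i hk).2.2.1 (hB₁ (by simp))
          · exact hB₁ (.inr (ih i hlt (by omega)))
        · exact hB₁ (by simp)
      · intro i hi hik hzi
        rw [if_pos (by omega)] at hzi
        rw [if_pos (by omega), if_pos (by omega)]
        obtain ⟨j, rfl⟩ : ∃ j, i = j + 1 := ⟨i - 1, by omega⟩
        obtain rfl | hlt : j = k ∨ j < k := by omega
        · exact absurd hzi hz
        · rw [if_pos (by omega)]
          exact (hc₁ j (by omega)).1
  have hmem' : ∀ {G : DMG (V ⊕ S)}, x (n + 1) ∈ antSet G (x 0) (x (n + 2)) Z →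
      ∀ i ≤ n + 2, x i ∈ antSet G (x 0) (x (n + 2)) Z := by
    intro G hn i hi
    rcases i with _ | i
    · exact endpoints_union_subset_antSet _ _ _ (by simp)
    obtain hlt | rfl | rfl : i < n ∨ i = n ∨ i = n + 1 := by omega
    · exact endpoints_union_subset_antSet _ _ _ (.inr (hmem i hlt))
    · exact hn
    · exact endpoints_union_subset_antSet _ _ _ (by simp)
  -- Inside `Z`, the collider `x (n + 1)` opens the whole walk in the first graph. Outside `Z`, a
  -- non-collider there would open it in the second, being anterior to a neighbour.
  by_cases hz : x (n + 1) ∈ Z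
  · refine absurd ⟨rfl, rfl, hadj₁, hmem' (hB₁ (.inr hz)), ?_⟩ (hno₁ (m := n + 2) (w := x))
    intro i hi hin _
    obtain ⟨j, rfl⟩ : ∃ j, i = j + 1 := ⟨i - 1, by omega⟩
    obtain rfl | hlt : j = n ∨ j < n := by omega
    · exact hc
    · exact (hc₁ j hlt).1
  · by_contra hnc
    have hle : AntLE G₂ (x (n + 1)) (x n) ∨ AntLE G₂ (x (n + 1)) (x (n + 2)) := by
      by_contra hcon
      exact hnc (not_or.1 hcon)
    have hxn : x n ∈ antSet G₂ (x 0) (x (n + 2)) Z := by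
      rcases n with _ | n
      · exact hB₂ (by simp)
      · exact hB₂ (.inr (hmem n (by omega)))
    refine hno₂ (m := n + 2) (w := x) ⟨rfl, rfl, hadj₂, hmem' ?_, ?_⟩
    · rcases hle with hle | hle
      · exact mem_antSet_of_antLE hle hxn
      · exact mem_antSet_of_antLE hle (hB₂ (by simp))
    · intro i hi hin hzi
      obtain ⟨j, rfl⟩ : ∃ j, i = j + 1 := ⟨i - 1, by omega⟩
      obtain rfl | hlt : j = n ∨ j < n := by omega
      · exact absurd hzi hz
      · exact hc₂ j hlt

theorem sameBasicColliders (h₁ : H₁.Represents G₁) (h₂ : H₂.Represents G₂) (hH₁ : H₁.IsSigmaMAG)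
    (hH₂ : H₂.IsSigmaMAG)
    (h : ∀ (a b : V) (Z : Set V), a ≠ b → a ∉ Z → b ∉ Z → (Connects G₁ a b Z ↔ Connects G₂ a b Z)) :
    H₁.SameBasicColliders H₂ := by
  have hs : ∀ (a b : V) (Z : Set V), a ≠ b → a ∉ Z → b ∉ Z →
      (Connects G₂ a b Z ↔ Connects G₁ a b Z) := fun a b Z h1 h2 h3 => (h a b Z h1 h2 h3).symm
  have hadj : ∀ a b, H₁.Adj a b ↔ H₂.Adj a b := fun a b =>
    ⟨h₁.adj_of_adj h₂ hH₁ fun a b Z h1 h2 h3 => (h a b Z h1 h2 h3).1,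
      h₂.adj_of_adj h₁ hH₂ fun a b Z h1 h2 h3 => (h a b Z h1 h2 h3).2⟩
  refine ⟨hadj, fun a b c => ?_, ?_⟩
  · rw [h₁.isUnshieldedCollider_iff hH₁, h₂.isUnshieldedCollider_iff hH₂, ← hadj, ← hadj, ← hadj]
    refine and_congr_right fun hac => and_congr_right fun hna => and_congr_right fun hab =>
      and_congr_right fun hbc => ?_
    let x : ℕ → V := fun i => if i = 0 then a else if i = 1 then b else c
    have hx : ∀ i < 0 + 2, H₁.Adj (x i) (x (i + 1)) := by
      intro i hi
      obtain rfl | rfl : i = 0 ∨ i = 1 := by omega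
      · exact hab
      · exact hbc
    have hx' : ∀ i < 0 + 2, H₂.Adj (x i) (x (i + 1)) := fun i hi => (hadj _ _).1 (hx i hi)
    exact ⟨h₁.coll_of_coll h₂ hH₁ hH₂ h (n := 0) (x := x) hac hna hx hx'
        (fun k hk => absurd hk (by omega)) (fun k hk => absurd hk (by omega)),
      h₂.coll_of_coll h₁ hH₂ hH₁ hs (n := 0) (x := x) hac (fun h => hna ((hadj _ _).2 h)) hx' hx
        (fun k hk => absurd hk (by omega)) (fun k hk => absurd hk (by omega))⟩
  · intro π₁ π₂ v hlen hnode hd₁ hd₂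
    obtain ⟨n, hn, hp, hv, hna, hc₁⟩ := (h₁.isDiscriminating_iff hH₁).1 hd₁
    obtain ⟨n', hn', hp', hv', hna', hc₂⟩ := (h₂.isDiscriminating_iff hH₂).1 hd₂
    obtain rfl : n' = n := by omega
    have e₁ := h₁.hasCollider_iff hH₁ hp (k := n' + 1) (by omega)
    have e₂ := h₂.hasCollider_iff hH₂ hp' (k := n' + 1) (by omega)
    rw [show n' + 1 + 1 = n' + 2 by omega] at e₁ e₂
    rw [hv] at e₁
    rw [hv'] at e₂
    have hadj₁ : ∀ i < n' + 1 + 2, H₁.Adj (π₁.node i) (π₁.node (i + 1)) :=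
      fun i hi => ⟨_, _, π₁.isEdge i (by omega)⟩
    have hadj₂ : ∀ i < n' + 1 + 2, H₂.Adj (π₁.node i) (π₁.node (i + 1)) :=
      fun i hi => (hadj _ _).1 (hadj₁ i hi)
    have hne : π₁.node 0 ≠ π₁.node (n' + 1 + 2) := fun e => by
      have := hp 0 (by omega) (n' + 1 + 2) (by omega) e
      omega
    have hc₂' : ∀ k < n' + 1,
        (h₂.anteriorGraph hH₂).Coll (π₁.node k) (π₁.node (k + 1)) (π₁.node (k + 2)) ∧
        (h₂.anteriorGraph hH₂).Dir (π₁.node (k + 1)) (π₁.node (n' + 1 + 2)) := by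
      intro k hk
      rw [hnode k (by omega), hnode (k + 1) (by omega), hnode (k + 2) (by omega),
        hnode (n' + 1 + 2) (by omega)]
      exact hc₂ k (by omega)
    have hc₁' := fun k (hk : k < n' + 1) => hc₁ k (by omega)
    rw [← hv', ← hnode (n' + 2) (by omega), hv, ← hnode (n' + 1) (by omega),
      ← hnode (n' + 1 + 2) (by omega)] at e₂
    have hvv : π₁.node (n' + 2) = v := hv
    refine e₁.trans (Iff.trans ?_ e₂.symm)
    rw [← hvv]
    exact ⟨h₁.coll_of_coll h₂ hH₁ hH₂ h hne hna hadj₁ hadj₂ hc₁' (fun k hk => (hc₂' k hk).1),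
      h₂.coll_of_coll h₁ hH₂ hH₁ hs hne (fun h => hna ((hadj _ _).2 h)) hadj₂ hadj₁ hc₂'
        (fun k hk => (hc₁' k hk).1)⟩

end Represents

end MixedGraph

theorem mainTheorem4 {V S : Type*} (G₁ G₂ : DMG (V ⊕ S)) (H₁ H₂ : MixedGraph V)
    (hH₁ : H₁.IsSigmaMAG) (hH₂ : H₂.IsSigmaMAG)
    (hrep₁ : H₁.Represents G₁) (hrep₂ : H₂.Represents G₂) :
    DMG.SigmaMarkovEquiv G₁ G₂ ↔ MixedGraph.SameBasicColliders H₁ H₂ := by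
  rw [MixedGraph.sigmaMarkovEquiv_iff]
  constructor
  · exact hrep₁.sameBasicColliders hrep₂ hH₁ hH₂
  · intro h a b Z hab ha hb
    have hs : H₂.SameBasicColliders H₁ :=
      ⟨fun a b => (h.adj a b).symm, fun a b c => (h.unshielded a b c).symm,
        fun π₂ π₁ v hlen hnode h2 h1 => (h.discriminating π₁ π₂ v hlen.symm
          (fun i hi => (hnode i (by omega)).symm) h1 h2).symm⟩
    exact ⟨hrep₁.connects_transfer hrep₂ hH₁ hH₂ h hab ha hb,
      hrep₂.connects_transfer hrep₁ hH₂ hH₁ hs hab ha hb⟩
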